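/- **Setting.** An *instance* of a threshold-based stochastic problem consists of $n$ items, a support $a_1<\dots<a_k$ of real numbers ($k\ge 1$), constraints given by a non-empty set $\mathcal C$ of feasible policies, an objective $f\ge 0$, and a finite description of these data (the size $|I|$ of the instance includes $n$ and $k$ in magnitude). A (threshold) *policy* $\sigma$ is a decision tree whose internal nodes are labelled by pairs $(c,i)$, $c\in[k]$, $i\in[n]$: item $i$ is probed with threshold $a_c$, the censored value $\min(X_i,a_c)$ is observed, and the branches correspond to its possible values $a_1,\dots,a_c$. Every feasible policy probes each item at most once in every execution. The value $f(\sigma,x)\ge 0$ of running $\sigma$ on the realization $x$ depends only on the sequence of probed item-threshold pairs and the realizations of the probed items, and $f_{\max}$ is the maximum of $f(\sigma,x)$ over $\sigma\in\mathcal C$ and all $x$. For a product distribution $\mathbf D=\{\mathcal D_i\}_{i=1}^n$ on $\{a_1,\dots,a_k\}^n$ put $f(\sigma\mid\mathbf D)=\mathbb E_{x\sim\mathbf D}f(\sigma,x)$, and let $\mathrm{OPT}_I(\mathbf D)$ be the minimum (for a maximization problem: the maximum) of $f(\sigma\mid\mathbf D)$ over $\sigma\in\mathcal C$. A *problem* $\mathcal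 P$ is a set of instances together with the choice between minimization and maximization. It is *up-monotone* (*down-monotone*) if for every instance $I$ and all $\mathbf D,\mathbf E$ such that $\mathbf E$ stochastically dominates $\mathbf D$, $\mathrm{OPT}_I(\mathbf E)\le\mathrm{OPT}_I(\mathbf D)$ (respectively $\mathrm{OPT}_I(\mathbf E)\ge\mathrm{OPT}_I(\mathbf D)$). A *polynomial-time $\alpha$-approximation algorithm via threshold policies* is given an instance $I$ and rational distributions $\mathbf D$ (as natural-number weights in binary, proportional to the probabilities) and provides a policy $\sigma\in\mathcal C$ with $f(\sigma\mid\mathbf D)\le\alpha\,\mathrm{OPT}_I(\mathbf D)$ (minimization, $\alpha\ge1$) or $f(\sigma\mid\mathbf D)\ge\alpha\,\mathrm{OPT}_I(\mathbf D)$ (maximization, $\alpha\le1$), in the form of a program that, from $I$, $\mathbf D$ and the current state of the policy (the probes made so far and their censored outcomes), computes the next decision (a pair $(c,i)$, or stop) in time polynomial in the size of $(I,\mathbf D)$. A *polynomial-time censored feedback learning algorithm* is a program that is given $I$, the horizon $T$, the censored feedback $\{\min(x_i^s,a_c):(c,i)\in S(\sigma^s,x^s)\}$ of the earlier periods $s<t$,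 where $S(\sigma,x)$ is the sequence of pairs probed by $\sigma$ on $x$, and the current state within period $t\le T$, and computes the next decision of a policy $\sigma^t\in\mathcal C$ in time polynomial in $|I|+T$. The realizations $x^1,\dots,x^T$ are independent with distribution $\mathbf D$, which is unknown to the algorithm. The *$\alpha$-regret* is $\mathbb E\big[\sum_{t=1}^T f(\sigma^t,x^t)\big]-\alpha\,T\,\mathrm{OPT}_I(\mathbf D)$ for minimization and $\alpha\,T\,\mathrm{OPT}_I(\mathbf D)-\mathbb E\big[\sum_{t=1}^T f(\sigma^t,x^t)\big]$ for maximization. **Theorem.** There is an absolute constant $C>0$ such that the following holds. Let $\mathcal P$ be a threshold-based stochastic problem that is up-monotone or down-monotone and such that for every feasible policy $\sigma$ the function $f(\sigma,\cdot)$ is constant at each leaf of $\sigma$ (two realizations with the same censored observations have the same value). Suppose that $\mathcal P$ has a polynomial-time $\alpha$-approximation algorithm via threshold policies. Then $\mathcal P$ has a polynomial-time censored feedback learning algorithm whose $\alpha$-regret is, for every instance, every $T$ and every product distribution $\mathbf D$ on the support, at most $$C\,n\,k\,f_{\max}\sqrt{k\,T\,\log(k\,n\,T)} .$$ (When $n=0$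 or $T=0$ the bound is read as $0$.) -/

import Mathlib

/-! ## A machine model with a running time: while-programs on binary trees -/

namespace Censored

/-- Data values: binary trees. -/
inductive Data : Type
  | nil : Data
  | pair : Data → Data → Data

/-- The number of nodes of a tree. -/
def Data.size : Data → ℕ
  | .nil => 1
  | .pair a b => a.size + b.size + 1

/-- Programs of a while-language that transforms one tree (the store).
`loop p` is `while the left part of the store is not nil do p`. -/
inductive Prog : Type
  | id : Prog
  | const : Prog
  | left : Prog
  | right : Prog
  | pair : Prog → Prog → Prog
  | seq : Prog → Prog → Prog
  | ite : Prog → Prog → Prog → Prog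
  | loop : Prog → Prog

/-- `p.Runs x y t`: on input `x` the program `p` halts with output `y` after time `t`.
Each operation is charged the size of the tree it reads, so that the length of the output is
bounded by the running time, and polynomial time in this model is polynomial time on
Turing machines. -/
inductive Prog.Runs : Prog → Data → Data → ℕ → Prop
  | id (x : Data) : Prog.Runs .id x x x.size
  | const (x : Data) : Prog.Runs .const x .nil x.size
  | left_nil : Prog.Runs .left .nil .nil 1
  | left_pair (a b : Data) : Prog.Runs .left (.pair a b) a (Data.pair a b).size
  | right_nil : Prog.Runs .right .nil .nil 1
  | right_pair (a b : Data) : Prog.Runs .right (.pair a b) b (Data.pair a b).size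
  | pair {p q : Prog} {x a b : Data} {s t : ℕ} :
      Prog.Runs p x a s → Prog.Runs q x b t → Prog.Runs (.pair p q) x (.pair a b) (s + t + x.size)
  | seq {p q : Prog} {x y z : Data} {s t : ℕ} :
      Prog.Runs p x y s → Prog.Runs q y z t → Prog.Runs (.seq p q) x z (s + t + x.size)
  | ite_true {p q r : Prog} {x a b y : Data} {s t : ℕ} :
      Prog.Runs p x (.pair a b) s → Prog.Runs q x y t →
        Prog.Runs (.ite p q r) x y (s + t + x.size)
  | ite_false {p q r : Prog} {x y : Data} {s t : ℕ} :
      Prog.Runs p x .nil s → Prog.Runs r x y t → Prog.Runs (.ite p q r) x y (s + t + x.size)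
  | loop_nil {p : Prog} : Prog.Runs (.loop p) .nil .nil 1
  | loop_stop {p : Prog} (b : Data) :
      Prog.Runs (.loop p) (.pair .nil b) (.pair .nil b) (Data.pair .nil b).size
  | loop_step {p : Prog} {a b c y z : Data} {s t : ℕ} :
      Prog.Runs p (.pair (.pair a b) c) y s → Prog.Runs (.loop p) y z t →
        Prog.Runs (.loop p) (.pair (.pair a b) c) z (s + t + (Data.pair (.pair a b) c).size)

/-- A list of trees as a tree. -/
def Data.ofList : List Data → Data
  | [] => .nil
  | a :: l => .pair a (Data.ofList l)

/-- A number in unary (used for indices, for the dimensions and for the horizon). -/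
def Data.unary (m : ℕ) : Data := Data.ofList (List.replicate m .nil)

/-- A number in binary, least significant digit first. -/
def Data.binary (m : ℕ) : Data :=
  Data.ofList (m.bits.map fun b => if b then .pair .nil .nil else .nil)

/-! ## Threshold policies -/

/-- One probe together with what it shows: the item, the index of the threshold, and the index
of a support value. -/
abbrev Obs (n k : ℕ) : Type := Fin n × Fin k × Fin k

/-- Threshold policies for `n` items with support `a 0 < ⋯ < a (k-1)`, as decision trees. At a node
`probe i c next`, item `i` is probed with threshold `a c`; the branches are the possible values
`a j`, `j ≤ c`, of the censored observation `min (X i) (a c)`. -/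
inductive Policy (n k : ℕ) : Type
  | leaf : Policy n k
  | probe (i : Fin n) (c : Fin k) (next : Set.Iic c → Policy n k) : Policy n k

namespace Policy

variable {n k : ℕ}

/-- The sequence of item-threshold pairs probed by the policy when `X i = a (x i)` for all `i`. -/
def probes : Policy n k → (Fin n → Fin k) → List (Fin n × Fin k)
  | leaf, _ => []
  | probe i c next, x => (i, c) :: (next ⟨min (x i) c, Set.mem_Iic.2 (min_le_right _ _)⟩).probes x

/-- The censored feedback: the probes made and, for each of them, the (index of the) value
`min (X i) (a c)`. It determines the leaf that is reached. -/
def trace (σ : Policy n k) (x : Fin n → Fin k) : List (Obs n k) :=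
  (σ.probes x).map fun p => (p.1, p.2, min (x p.1) p.2)

/-- The probes made and the uncensored realizations of the probed items. -/
def realized (σ : Policy n k) (x : Fin n → Fin k) : List (Obs n k) :=
  (σ.probes x).map fun p => (p.1, p.2, x p.1)

/-- In every execution each item is probed at most once. -/
def ProbesOnce (σ : Policy n k) : Prop :=
  ∀ x, ((σ.probes x).map Prod.fst).Nodup

/-- The decision rule `act` (`act τ none`: stop in state `τ`; `act τ (some (i, c))`: probe `i` with
threshold `a c` in state `τ`) makes, from state `τ` on, the decisions of the given policy at all of
its nodes. -/
def Implements (act : List (Obs n k) → Option (Fin n × Fin k) → Prop) :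
    Policy n k → List (Obs n k) → Prop
  | leaf, τ => act τ none
  | probe i c next, τ =>
      act τ (some (i, c)) ∧ ∀ j, (next j).Implements act (τ ++ [(i, c, j.1)])

end Policy

/-- Encoding of a state of a policy. -/
def encTrace {n k : ℕ} (τ : List (Obs n k)) : Data :=
  Data.ofList (τ.map fun o => .pair (.unary o.1) (.pair (.unary o.2.1) (.unary o.2.2)))

/-- Encoding of a decision. -/
def encAction {n k : ℕ} : Option (Fin n × Fin k) → Data
  | none => .nil
  | some (i, c) => .pair (.unary i) (.unary c)

/-- Given `input` and the current state, the program `p` outputs the decision of `σ` in that state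
within time `bound`, at every node of `σ`. -/
def ComputesPolicy {n k : ℕ} (p : Prog) (input : Data) (bound : ℕ) (σ : Policy n k) : Prop :=
  σ.Implements
    (fun τ d => ∃ t ≤ bound, p.Runs (.pair input (encTrace τ)) (encAction d) t) []

/-! ## Stochastic problems -/

/-- An instance without its distributions: the items, the common support of the random variables,
the constraints (as the set of feasible policies), the objective, which is a function of the
sequence of probes and of the realizations of the probed items, and the tree `param` that
describes objective and constraints to an algorithm. -/
structure Instance where
  /-- number of items -/
  n : ℕ
  /-- support size -/
  k : ℕ
  k_pos : 0 < k
  /-- the support -/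
  a : Fin k → ℝ
  a_strictMono : StrictMono a
  feasible : Set (Policy n k)
  feasible_nonempty : feasible.Nonempty
  probesOnce : ∀ σ ∈ feasible, σ.ProbesOnce
  /-- objective value of an execution -/
  value : List (Obs n k) → ℝ
  value_nonneg : ∀ σ ∈ feasible, ∀ x, 0 ≤ value (σ.realized x)
  param : Data

/-- `Fin n → Fin k → ℝ` as probability mass functions of `n` independent variables. -/
def IsDist {n k : ℕ} (D : Fin n → Fin k → ℝ) : Prop := ∀ i, D i ∈ stdSimplex ℝ (Fin k)

/-- The probability of the realization `X i = a (x i)`, `i < n`, under the product distribution. -/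
def prob {n k : ℕ} (D : Fin n → Fin k → ℝ) (x : Fin n → Fin k) : ℝ := ∏ i, D i (x i)

/-- The probability mass functions with rational values given by natural numbers `w i j`:
`D i j` is proportional to `w i j`. -/
noncomputable def ratDist {n k : ℕ} (w : Fin n → Fin k → ℕ) : Fin n → Fin k → ℝ :=
  fun i j => (w i j : ℝ) / ∑ j', (w i j' : ℝ)

/-- Encoding of rational distributions; the weights are written in binary. -/
def encWeights {n k : ℕ} (w : Fin n → Fin k → ℕ) : Data :=
  Data.ofList (List.ofFn fun i => Data.ofList (List.ofFn fun j => Data.binary (w i j)))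

/-- Minimization or maximization. -/
inductive Goal : Type
  | minimize : Goal
  | maximize : Goal

/-- The convention for approximation ratios: `α ≥ 1` for minimization, `α ≤ 1` for maximization. -/
def Goal.IsRatio (α : ℝ) : Goal → Prop
  | .minimize => 1 ≤ α
  | .maximize => α ≤ 1

namespace Instance

/-- The value `a (min j c)` that a node observes is the censored value `min (a j) (a c)`. -/
theorem a_min (I : Instance) (j c : Fin I.k) : I.a (min j c) = min (I.a j) (I.a c) :=
  I.a_strictMono.monotone.map_min

/-- Encoding of an instance; `n` and `k` count with their magnitude. -/
def code (I : Instance) : Data := .pair (.unary I.n) (.pair (.unary I.k) I.param)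

/-- The objective `f(σ, x)`. -/
def f (I : Instance) (σ : Policy I.n I.k) (x : Fin I.n → Fin I.k) : ℝ := I.value (σ.realized x)

/-- The maximal objective value over feasible policies and realizations. -/
noncomputable def fMax (I : Instance) : ℝ := sSup {v | ∃ σ ∈ I.feasible, ∃ x, v = I.f σ x}

/-- The expected objective `f(σ | D)`. -/
noncomputable def expected (I : Instance) (D : Fin I.n → Fin I.k → ℝ) (σ : Policy I.n I.k) : ℝ :=
  ∑ x, prob D x * I.f σ x

/-- The optimal expected objective under `D`. -/
noncomputable def opt (I : Instance) (D : Fin I.n → Fin I.k → ℝ) : Goal → ℝ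
  | .minimize => sInf (I.expected D '' I.feasible)
  | .maximize => sSup (I.expected D '' I.feasible)

/-- The value of the objective is constant at each leaf of each policy: realizations with the same
censored observations lead to the same value. -/
def LeafConstant (I : Instance) : Prop :=
  ∀ σ ∈ I.feasible, ∀ x y, σ.trace x = σ.trace y → I.f σ x = I.f σ y

/-- `E` stochastically dominates `D`: `Pr(X i ≥ r)` is at least as large under `E`. -/
def Dominates (I : Instance) (E D : Fin I.n → Fin I.k → ℝ) : Prop :=
  ∀ i, ∀ r : ℝ, ∑ j with r ≤ I.a j, D i j ≤ ∑ j with r ≤ I.a j, E i j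

/-- `σ` is an `α`-approximate policy under `D`. -/
def IsApprox (I : Instance) (D : Fin I.n → Fin I.k → ℝ) (α : ℝ) (σ : Policy I.n I.k) : Goal → Prop
  | .minimize => I.expected D σ ≤ α * I.opt D .minimize
  | .maximize => α * I.opt D .maximize ≤ I.expected D σ

end Instance

/-- A stochastic problem: a set of instances, and whether one minimizes or maximizes. -/
structure Problem where
  goal : Goal
  instances : Set Instance

namespace Problem

def UpMonotone (P : Problem) : Prop :=
  ∀ I ∈ P.instances, ∀ D E, IsDist D → IsDist E → I.Dominates E D →
    I.opt E P.goal ≤ I.opt D P.goal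

def DownMonotone (P : Problem) : Prop :=
  ∀ I ∈ P.instances, ∀ D E, IsDist D → IsDist E → I.Dominates E D →
    I.opt D P.goal ≤ I.opt E P.goal

/-- There is a polynomial-time `α`-approximation algorithm: for each instance and each choice of
rational distributions it gives a feasible `α`-approximate policy, each decision of which is
computed in time polynomial in the size of the instance and of the distributions. -/
def HasApproxAlgorithm (P : Problem) (α : ℝ) : Prop :=
  ∃ (A : Prog) (q : Polynomial ℕ), ∀ I ∈ P.instances, ∀ w : Fin I.n → Fin I.k → ℕ,
    (∀ i, 0 < ∑ j, w i j) →
      ∃ σ ∈ I.feasible, I.IsApprox (ratDist w) α σ P.goal ∧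
        ComputesPolicy A (.pair I.code (encWeights w))
          (q.eval (I.code.size + (encWeights w).size)) σ

end Problem

/-! ## Online learning with censored feedback -/

/-- A strategy of the learner: the policy of the next period as a function of the censored feedback
of all earlier periods. -/
abbrev Strategy (n k : ℕ) : Type := List (List (Obs n k)) → Policy n k

/-- The feedback received when the realizations of the successive periods are `xs`. -/
def Strategy.history {n k : ℕ} (S : Strategy n k) (xs : List (Fin n → Fin k)) :
    List (List (Obs n k)) :=
  xs.foldl (fun h x => h ++ [(S h).trace x]) []

/-- Encoding of the feedback of the earlier periods. -/
def encHistory {n k : ℕ} (h : List (List (Obs n k))) : Data := Data.ofList (h.map encTrace)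

namespace Instance

/-- The expected total objective over `T` periods with independent realizations drawn from `D`. -/
noncomputable def expectedTotal (I : Instance) (D : Fin I.n → Fin I.k → ℝ) (T : ℕ)
    (S : Strategy I.n I.k) : ℝ :=
  ∑ xs : Fin T → Fin I.n → Fin I.k, (∏ t, prob D (xs t)) *
    ∑ t : Fin T, I.f (S (S.history ((List.ofFn xs).take t))) (xs t)

/-- The expected `α`-regret over `T` periods. -/
noncomputable def regret (I : Instance) (D : Fin I.n → Fin I.k → ℝ) (T : ℕ)
    (S : Strategy I.n I.k) (α : ℝ) : Goal → ℝ
  | .minimize => I.expectedTotal D T S - α * T * I.opt D .minimize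
  | .maximize => α * T * I.opt D .maximize - I.expectedTotal D T S

/-- The program `L` carries out the strategy `S` over horizon `T`: in every period and after all
possible realizations `xs` of the earlier periods, the policy of `S` is feasible, and each of its
decisions is computed by `L` within time `bound` from the instance, `T`, the censored feedback of
the earlier periods and the censored observations made so far in the current period.
(The whole run consists of at most `T * (n + 1)` such decisions.) -/
def Carries (I : Instance) (L : Prog) (T : ℕ) (bound : ℕ) (S : Strategy I.n I.k) : Prop :=
  ∀ xs : List (Fin I.n → Fin I.k), xs.length < T →
    S (S.history xs) ∈ I.feasible ∧
      ComputesPolicy L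
        (.pair I.code (.pair (.unary T) (encHistory (S.history xs)))) bound (S (S.history xs))

end Instance

end Censored

open Censored

namespace Censored

/-! ## Polynomial-time functions between encoded types -/

/-! The learner is optimistic in the face of uncertainty. A probe of item `i` with threshold index
`c` reveals exactly, for every `j ≤ c`, whether the value has index at least `j`. Hence each tail
probability of each item is estimated from all probes of that item whose threshold is high enough.
Depending on the goal and the direction of monotonicity, all tails are replaced by upper or all by
lower confidence bounds (`Problem.exists_side`). The resulting product distribution has an optimum
at least as good as the true one, and the learner plays the approximate policy for it.

The `α`-loss of a period is then at most the difference between the values of the played policy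
under the estimated and the true distributions (`Instance.loss_le`). Since the objective is constant
at leaves, a hybrid argument along the decision tree (`abs_pexp_sub_pexp_le`) bounds this difference
by `fMax` times the expected sum, over the probes `(i, c)` made, of the tail errors of item `i` at
indices `1, …, c`. These are exactly the tails for which the probe supplies a new sample. An error
of order `√(ℓ / (N + 1))` after `N` samples is therefore paid for by the increase of `√ℓ * √N`, and
the sum over the periods telescopes (`radius_mul_le`, `sum_listExp_le`).

The samples are collected adaptively, so concentration comes from an exponential supermartingale
(`listExp_exp_le_one`) and a union bound over items, indices and possible sample counts
(`listExp_not_accurate_le`). A period with a wrong confidence interval costs at most `fMax`.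

For the running time, bounded folds (`PolyTime.foldl`) give a small library of polynomial-time
functions. The estimates use only integer arithmetic: probabilities are multiples of `1 / (T + 1)`,
and a binary length replaces the logarithm. The program for the estimates is composed with the
approximation algorithm (`exists_learner`). -/

theorem Data.size_pos (d : Data) : 0 < d.size := by cases d <;> simp [Data.size]

/-- Every operation is charged for the store that it reads, so running time also controls output
size. This is what keeps compositions of polynomial-time programs polynomial. -/
theorem Prog.Runs.size_le {p : Prog} {x y : Data} {t : ℕ} (h : p.Runs x y t) : y.size ≤ t := by
  induction h with
  | const x => exact x.size_pos
  | @pair p q x => have := x.size_pos; simp only [Data.size]; omega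
  | _ => (try simp only [Data.size] at *); omega

theorem eval_mono (q : Polynomial ℕ) {m n : ℕ} (h : m ≤ n) : q.eval m ≤ q.eval n := by
  rw [Polynomial.eval_eq_sum_range, Polynomial.eval_eq_sum_range]
  gcongr

/-- Types whose elements are encoded as binary trees. -/
class ToData (α : Type*) where
  /-- the encoding -/
  enc : α → Data


instance : ToData Data := ⟨fun d => d⟩
instance : ToData ℕ := ⟨Data.unary⟩
instance : ToData Bool := ⟨fun b => if b then .pair .nil .nil else .nil⟩
instance {α β : Type*} [ToData α] [ToData β] : ToData (α × β) :=
  ⟨fun p => .pair (ToData.enc p.1) (ToData.enc p.2)⟩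
instance {α : Type*} [ToData α] : ToData (List α) := ⟨fun l => Data.ofList (l.map ToData.enc)⟩

open ToData

variable {α β γ : Type*} [ToData α] [ToData β] [ToData γ]

/-- The length of the encoding. -/
def encSize (a : α) : ℕ := (enc a).size

theorem encSize_pos (a : α) : 0 < encSize a := Data.size_pos _

@[simp] theorem encSize_pair (a : α) (b : β) : encSize (a, b) = encSize a + encSize b + 1 := rfl
@[simp] theorem encSize_nil : encSize ([] : List α) = 1 := rfl
@[simp] theorem encSize_cons (a : α) (l : List α) :
    encSize (a :: l) = encSize a + encSize l + 1 := rfl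

@[simp] theorem encSize_nat (m : ℕ) : encSize m = 2 * m + 1 := by
  show (Data.unary m).size = _
  unfold Data.unary
  induction m with
  | zero => rfl
  | succ m ih => simp only [List.replicate_succ, Data.ofList, Data.size, ih]; ring

theorem encSize_bool_le (b : Bool) : encSize b ≤ 3 := by cases b <;> decide

@[simp] theorem encSize_append (l m : List α) :
    encSize (l ++ m) + 1 = encSize l + encSize m := by
  induction l with
  | nil => simp [add_comm]
  | cons a l ih => simp only [List.cons_append, encSize_cons]; omega

theorem length_lt_encSize (l : List α) : l.length < encSize l := by
  induction l with
  | nil => simp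
  | cons a l ih => simp only [List.length_cons, encSize_cons]; omega

theorem encSize_le_of_mem {a : α} {l : List α} (h : a ∈ l) : encSize a ≤ encSize l := by
  induction l with
  | nil => simp at h
  | cons b l ih =>
    rcases List.mem_cons.1 h with rfl | h
    · simp only [encSize_cons]; omega
    · have := ih h
      simp only [encSize_cons]; omega

/-- If all elements are of size at most `B`, then so is the list up to the factor `length + 1`. -/
theorem encSize_le_of_forall {l : List α} {B : ℕ} (h : ∀ a ∈ l, encSize a ≤ B) :
    encSize l ≤ l.length * (B + 1) + 1 := by
  induction l with
  | nil => simp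
  | cons b l ih =>
    have h1 := h b (by simp)
    have h2 := ih fun a ha => h a (by simp [ha])
    simp only [encSize_cons, List.length_cons]
    linarith

/-- `f` is computed by a program in polynomial time. -/
def PolyTime (f : α → β) : Prop :=
  ∃ (p : Prog) (q : Polynomial ℕ), ∀ a, ∃ t ≤ q.eval (encSize a), p.Runs (enc a) (enc (f a)) t

theorem PolyTime.size_bound {f : α → β} (hf : PolyTime f) :
    ∃ q : Polynomial ℕ, ∀ a, encSize (f a) ≤ q.eval (encSize a) := by
  obtain ⟨p, q, h⟩ := hf
  refine ⟨q, fun a => ?_⟩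
  obtain ⟨t, ht, hr⟩ := h a
  exact hr.size_le.trans ht

/-- A function that does not change the encoding. -/
theorem PolyTime.recode {f : α → β} (h : ∀ a, enc (f a) = enc a) : PolyTime f :=
  by
  refine ⟨Prog.id, .X, fun a => ⟨_, ?_, by rw [h a]; exact Prog.Runs.id _⟩⟩
  simp [encSize]

theorem PolyTime.id' : PolyTime (fun a : α => a) := .recode fun _ => rfl

theorem PolyTime.comp {g : β → γ} {f : α → β} (hg : PolyTime g) (hf : PolyTime f) :
    PolyTime (fun a => g (f a)) := by
  obtain ⟨p, q, hp⟩ := hf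
  obtain ⟨p', q', hp'⟩ := hg
  refine ⟨.seq p p', q + q'.comp q + .X, fun a => ?_⟩
  obtain ⟨s, hs, h1⟩ := hp a
  obtain ⟨t, ht, h2⟩ := hp' (f a)
  refine ⟨_, ?_, .seq h1 h2⟩
  have : encSize (f a) ≤ q.eval (encSize a) := h1.size_le.trans hs
  have := eval_mono q' this
  simp only [Polynomial.eval_add, Polynomial.eval_comp, Polynomial.eval_X]
  unfold encSize at *
  omega

theorem PolyTime.pair {f : α → β} {g : α → γ} (hf : PolyTime f) (hg : PolyTime g) :
    PolyTime (fun a => (f a, g a)) := by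
  obtain ⟨p, q, hp⟩ := hf
  obtain ⟨p', q', hp'⟩ := hg
  refine ⟨.pair p p', q + q' + .X, fun a => ?_⟩
  obtain ⟨s, hs, h1⟩ := hp a
  obtain ⟨t, ht, h2⟩ := hp' a
  refine ⟨_, ?_, .pair h1 h2⟩
  simp only [Polynomial.eval_add, Polynomial.eval_X]
  unfold encSize at *
  omega

theorem PolyTime.fst : PolyTime (fun p : α × β => p.1) :=
  ⟨.left, .X, fun a => ⟨_, by simp [encSize]; rfl, .left_pair _ _⟩⟩

theorem PolyTime.snd : PolyTime (fun p : α × β => p.2) :=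
  ⟨.right, .X, fun a => ⟨_, by simp [encSize]; rfl, .right_pair _ _⟩⟩

theorem PolyTime.fst' {f : α → β × γ} (hf : PolyTime f) : PolyTime (fun a => (f a).1) :=
  PolyTime.comp .fst hf

theorem PolyTime.snd' {f : α → β × γ} (hf : PolyTime f) : PolyTime (fun a => (f a).2) :=
  PolyTime.comp .snd hf

/-- A fixed tree is hardwired into the program, by recursion on the tree. -/
theorem PolyTime.const (b : β) : PolyTime (fun _ : α => b) := by
  suffices h : ∀ d : Data, PolyTime (fun _ : α => d) by
    obtain ⟨p, q, hp⟩ := h (enc b)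
    exact ⟨p, q, hp⟩
  intro d
  induction d with
  | nil => exact ⟨.const, .X, fun a => ⟨_, by simp [encSize], .const _⟩⟩
  | pair d e hd he =>
    obtain ⟨p, q, hp⟩ := PolyTime.pair hd he
    exact ⟨p, q, hp⟩

/-- A nonempty list is encoded as the pair of its head and its tail, so the program that forms pairs
already does this. -/
theorem PolyTime.cons {f : α → β} {g : α → List β} (hf : PolyTime f) (hg : PolyTime g) :
    PolyTime (fun a => f a :: g a) := by
  obtain ⟨p, q, hp⟩ := PolyTime.pair hf hg
  exact ⟨p, q, hp⟩

theorem PolyTime.succ {f : α → ℕ} (hf : PolyTime f) : PolyTime (fun a => f a + 1) := by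
  obtain ⟨p, q, hp⟩ := PolyTime.pair (.const Data.nil) hf
  exact ⟨p, q, hp⟩

theorem PolyTime.ite {c : α → Prop} [DecidablePred c] {f g : α → β}
    (hc : PolyTime (fun a => decide (c a))) (hf : PolyTime f) (hg : PolyTime g) :
    PolyTime (fun a => if c a then f a else g a) := by
  obtain ⟨p, q, hp⟩ := hc
  obtain ⟨p', q', hp'⟩ := hf
  obtain ⟨p'', q'', hp''⟩ := hg
  refine ⟨.ite p p' p'', q + q' + q'' + .X, fun a => ?_⟩
  obtain ⟨s, hs, h0⟩ := hp a
  by_cases h : c a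
  · obtain ⟨t, ht, h1⟩ := hp' a
    simp only [h, decide_true, if_true] at h0 ⊢
    refine ⟨_, ?_, .ite_true h0 h1⟩
    simp only [Polynomial.eval_add, Polynomial.eval_X]
    unfold encSize at *
    omega
  · obtain ⟨t, ht, h1⟩ := hp'' a
    simp only [h, decide_false, if_false] at h0 ⊢
    refine ⟨_, ?_, .ite_false h0 h1⟩
    simp only [Polynomial.eval_add, Polynomial.eval_X]
    unfold encSize at *
    omega

/-- A loop that consumes a list. -/
theorem runs_loop_foldl {p : Prog} {q : Polynomial ℕ} {f : γ → β → α → β}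
    (hp : ∀ a l b c, ∃ t ≤ q.eval (encSize (a :: l, b, c)),
      p.Runs (enc (a :: l, b, c)) (enc (l, f c b a, c)) t) (B : ℕ) (c : γ) (l : List α) :
    ∀ b, (∀ l₁ l₂, l = l₁ ++ l₂ → encSize (l₂, l₁.foldl (f c) b, c) ≤ B) →
      ∃ t ≤ l.length * (q.eval B + B) + B,
        (Prog.loop p).Runs (enc (l, b, c)) (enc (([] : List α), l.foldl (f c) b, c)) t := by
  induction l with
  | nil =>
    intro b hB
    refine ⟨_, (hB [] [] rfl).trans (by simp), ?_⟩
    change (Prog.loop p).Runs (.pair .nil (enc (b, c))) (.pair .nil (enc (b, c)))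
      (Data.pair .nil (enc (b, c))).size
    constructor
  | cons a l ih =>
    intro b hB
    obtain ⟨t, ht, hr⟩ := ih (f c b a) fun l₁ l₂ h => hB (a :: l₁) l₂ (by simp [h])
    obtain ⟨s, hs, hr'⟩ := hp a l b c
    have h0 : encSize (a :: l, b, c) ≤ B := hB [] _ rfl
    refine ⟨_, ?_, .loop_step hr' hr⟩
    have h1 := eval_mono q h0
    have h2 : encSize (a :: l, b, c) = (Data.pair (enc (a :: l)) (enc (b, c))).size := rfl
    change s + t + (Data.pair (enc (a :: l)) (enc (b, c))).size ≤ _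
    rw [← h2, List.length_cons, add_mul]
    omega

/-- Bounded recursion along a list: a fold is polynomial time if each step adds only polynomially
much to the size of the accumulator. -/
theorem PolyTime.foldl {l : γ → List α} {b : γ → β} {f : γ → β → α → β} (hl : PolyTime l)
    (hb : PolyTime b) (hf : PolyTime (fun p : γ × β × α => f p.1 p.2.1 p.2.2))
    (hs : ∃ P : Polynomial ℕ, ∀ c b a,
      encSize (f c b a) ≤ encSize b + P.eval (encSize c + encSize a)) :
    PolyTime (fun c => (l c).foldl (f c) (b c)) := by
  obtain ⟨P, hP⟩ := hs
  -- The loop needs its whole state in the store: the rest of the list, the accumulator and the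
  -- parameter.
  suffices H : PolyTime (fun s : List α × β × γ => (([] : List α), s.1.foldl (f s.2.2) s.2.1, s.2.2)) from
    PolyTime.fst' (PolyTime.snd' (PolyTime.comp H (.pair hl (.pair hb .id'))))
  have hbody : PolyTime (fun s : (α × List α) × β × γ => (s.1.2, f s.2.2 s.2.1 s.1.1, s.2.2)) :=
    .pair (.snd' .fst) (.pair (.comp hf (.pair (.snd' .snd) (.pair (.fst' .snd) (.fst' .fst))))
      (.snd' .snd))
  obtain ⟨p, q, hp⟩ := hbody
  -- Bound for every intermediate store: the initial size, plus at most size-many steps that each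
  -- add at most `P`.
  let R : Polynomial ℕ := .X + .X * P
  refine ⟨.loop p, .X * (q.comp R + R) + R, fun s => ?_⟩
  obtain ⟨l, b, c⟩ := s
  have hB : ∀ l₁ l₂, l = l₁ ++ l₂ →
      encSize (l₂, l₁.foldl (f c) b, c) ≤ R.eval (encSize (l, b, c)) := by
    intro l₁ l₂ h
    have key : ∀ (m : List α) (b' : β), (∀ a ∈ m, a ∈ l) → encSize (m.foldl (f c) b') ≤
        encSize b' + m.length * P.eval (encSize (l, b, c)) := by
      intro m
      induction m with
      | nil => simp
      | cons a m ih =>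
        intro b' hm
        have h1 := ih (f c b' a) fun x hx => hm x (by simp [hx])
        have h2 := hP c b' a
        have h3 : P.eval (encSize c + encSize a) ≤ P.eval (encSize (l, b, c)) := by
          apply eval_mono
          have := encSize_le_of_mem (hm a (by simp))
          simp only [encSize_pair]; omega
        simp only [List.foldl_cons, List.length_cons, add_mul]
        omega
    have h1 := key l₁ b fun a ha => by rw [h]; simp [ha]
    have h2 := encSize_append l₁ l₂
    rw [← h] at h2
    have h3 := length_lt_encSize l₁
    have h4 : l₁.length * P.eval (encSize (l, b, c)) ≤
        encSize (l, b, c) * P.eval (encSize (l, b, c)) := by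
      gcongr
      simp only [encSize_pair]
      have := encSize_pos l₂
      omega
    simp only [R, Polynomial.eval_add, Polynomial.eval_mul, Polynomial.eval_X]
    have h5 : encSize (l₂, l₁.foldl (f c) b, c) ≤ encSize (l, b, c) +
        l₁.length * P.eval (encSize (l, b, c)) := by
      simp only [encSize_pair] at h1 ⊢
      have := encSize_pos l₁
      omega
    omega
  obtain ⟨t, ht, hr⟩ := runs_loop_foldl (f := f) (p := p) (q := q)
    (fun a l b c => hp ((a, l), b, c)) _ c l b hB
  refine ⟨t, ht.trans ?_, hr⟩
  have h1 : l.length ≤ encSize (l, b, c) := by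
    have := length_lt_encSize l
    simp only [encSize_pair]; omega
  simp only [Polynomial.eval_add, Polynomial.eval_mul, Polynomial.eval_X, Polynomial.eval_comp]
  gcongr

end Censored

/-! ### Polynomial-time list operations and unary arithmetic -/

namespace Censored
open ToData

section
variable {α β γ : Type*} [ToData α] [ToData β] [ToData γ]

namespace PolyTime

theorem reverse {l : γ → List α} (hl : PolyTime l) : PolyTime (fun c => (l c).reverse) := by
  have h := foldl (b := fun _ : γ => ([] : List α)) (f := fun _ acc a => a :: acc) hl (const [])
    (cons (snd' snd) (fst' snd)) ⟨.X + 1, fun c b a => by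
      simp only [encSize_cons, Polynomial.eval_add, Polynomial.eval_X, Polynomial.eval_one]; omega⟩
  simpa only [List.foldl_flip_cons_eq_append', List.append_nil] using h

theorem append {l m : γ → List α} (hl : PolyTime l) (hm : PolyTime m) :
    PolyTime (fun c => l c ++ m c) := by
  have h := foldl (b := m) (f := fun _ acc a => a :: acc) (reverse hl) hm
    (cons (snd' snd) (fst' snd)) ⟨.X + 1, fun c b a => by
      simp only [encSize_cons, Polynomial.eval_add, Polynomial.eval_X, Polynomial.eval_one]; omega⟩
  simpa only [List.foldl_flip_cons_eq_append', List.reverse_reverse] using h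

theorem map {l : γ → List α} {f : γ → α → β} (hl : PolyTime l)
    (hf : PolyTime (fun p : γ × α => f p.1 p.2)) : PolyTime (fun c => (l c).map (f c)) := by
  obtain ⟨P, hP⟩ := hf.size_bound
  have h := foldl (b := fun _ : γ => ([] : List β)) (f := fun c acc a => f c a :: acc) hl (const [])
    (cons (comp hf (pair fst (snd' snd))) (fst' snd)) ⟨P.comp (.X + 1) + 1, fun c b a => by
      have := hP (c, a)
      simp only [encSize_cons, encSize_pair, Polynomial.eval_add, Polynomial.eval_comp,
        Polynomial.eval_X, Polynomial.eval_one] at this ⊢; omega⟩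
  have e : ∀ c (acc : List β) (l : List α),
      l.foldl (fun acc a => f c a :: acc) acc = (l.map (f c)).reverse ++ acc := by
    intro c acc l
    induction l generalizing acc with
    | nil => rfl
    | cons a l ih => simp [ih]
  simpa only [e, List.append_nil, List.reverse_reverse] using reverse h

theorem flatten {l : γ → List (List α)} (hl : PolyTime l) : PolyTime (fun c => (l c).flatten) := by
  have h := foldl (b := fun _ : γ => ([] : List α)) (f := fun _ acc a => acc ++ a) hl (const [])
    (append (fst' snd) (snd' snd)) ⟨.X, fun c b a => by
      have := encSize_append b a
      simp only [Polynomial.eval_X]; omega⟩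
  have e : ∀ (acc : List α) (l : List (List α)),
      l.foldl (fun acc a => acc ++ a) acc = acc ++ l.flatten := by
    intro acc l
    induction l generalizing acc with
    | nil => simp
    | cons a l ih => simp [ih]
  simpa only [e, List.nil_append] using h

/-- Numbers in unary are lists. -/
theorem replicate {f : γ → ℕ} (hf : PolyTime f) :
    PolyTime (fun c => List.replicate (f c) Data.nil) :=
  comp (g := fun m : ℕ => List.replicate m Data.nil) (recode fun m => by
    simp [enc, Data.unary]) hf

/-- Bounded recursion along a number. -/
theorem iterate {m : γ → ℕ} {b : γ → β} {f : γ → β → β} (hm : PolyTime m)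
    (hb : PolyTime b) (hf : PolyTime (fun p : γ × β => f p.1 p.2))
    (hs : ∃ P : Polynomial ℕ, ∀ c b, encSize (f c b) ≤ encSize b + P.eval (encSize c)) :
    PolyTime (fun c => (f c)^[m c] (b c)) := by
  obtain ⟨P, hP⟩ := hs
  have h := foldl (f := fun c b (_ : Data) => f c b) (replicate hm) hb
    (comp hf (pair fst (fst' snd)))
    ⟨P, fun c b a => (hP c b).trans (Nat.add_le_add_left (eval_mono P (Nat.le_add_right _ _)) _)⟩
  have e : ∀ c (m : ℕ) (b : β), (List.replicate m Data.nil).foldl (fun b _ => f c b) b =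
      (f c)^[m] b := by
    intro c m
    induction m with
    | zero => intro b; rfl
    | succ m ih => intro b; simp [List.replicate_succ, ih]
  simpa only [e] using h

theorem length {l : γ → List α} (hl : PolyTime l) : PolyTime (fun c => (l c).length) := by
  have h := foldl (b := fun _ : γ => (0 : ℕ)) (f := fun _ acc (_ : α) => acc + 1) hl (const 0)
    (succ (fst' snd)) ⟨2, fun c b a => by simp; omega⟩
  have e : ∀ (m : ℕ) (l : List α), l.foldl (fun acc _ => acc + 1) m = m + l.length := by
    intro m l
    induction l generalizing m with
    | nil => rfl
    | cons a l ih => simp [ih]; ring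
  simpa only [e, zero_add] using h

theorem pred {f : γ → ℕ} (hf : PolyTime f) : PolyTime (fun c => f c - 1) :=
  comp (g := fun m : ℕ => m - 1) ⟨.right, .X, fun m => by
    cases m with
    | zero => exact ⟨_, by simp, .right_nil⟩
    | succ m => exact ⟨_, by simp [encSize]; rfl, .right_pair _ _⟩⟩ hf

theorem add {f g : γ → ℕ} (hf : PolyTime f) (hg : PolyTime g) : PolyTime (fun c => f c + g c) := by
  have h := iterate (f := fun _ (m : ℕ) => m + 1) hg hf (succ snd) ⟨2, fun c b => by simp; omega⟩
  have e : ∀ m n : ℕ, (fun m : ℕ => m + 1)^[n] m = m + n := fun m n => by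
    simp [← Nat.succ_eq_add_one, Nat.succ_iterate]
  simpa only [e] using h

theorem sub {f g : γ → ℕ} (hf : PolyTime f) (hg : PolyTime g) : PolyTime (fun c => f c - g c) := by
  have h := iterate (f := fun _ (m : ℕ) => m - 1) hg hf (pred snd) ⟨2, fun c b => by simp; omega⟩
  have e : ∀ m n : ℕ, (fun m : ℕ => m - 1)^[n] m = m - n := fun m n => by
    induction n with
    | zero => rfl
    | succ n ih => rw [Function.iterate_succ_apply', ih, Nat.sub_sub]
  simpa only [e] using h

theorem mul {f g : γ → ℕ} (hf : PolyTime f) (hg : PolyTime g) : PolyTime (fun c => f c * g c) := by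
  obtain ⟨P, hP⟩ := hf.size_bound
  have h := iterate (b := fun _ : γ => 0) (f := fun c (m : ℕ) => m + f c) hg (const 0)
    (add snd (comp hf fst)) ⟨P, fun c b => by have := hP c; simp only [encSize_nat] at *; omega⟩
  have e : ∀ m n : ℕ, (fun r : ℕ => r + m)^[n] 0 = m * n := fun m n => by
    induction n with
    | zero => rfl
    | succ n ih => rw [Function.iterate_succ_apply', ih, Nat.mul_succ]
  simpa only [e] using h

theorem min {f g : γ → ℕ} (hf : PolyTime f) (hg : PolyTime g) :
    PolyTime (fun c => Min.min (f c) (g c)) := by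
  have h := sub hf (sub hf hg)
  -- Truncated subtraction yields the minimum.
  have e : ∀ c, f c - (f c - g c) = Min.min (f c) (g c) := fun c => by omega
  simpa only [e] using h

theorem decide_le {f g : γ → ℕ} (hf : PolyTime f) (hg : PolyTime g) :
    PolyTime (fun c => decide (f c ≤ g c)) := by
  have h0 : PolyTime (fun m : ℕ => decide (m = 0)) := by
    obtain ⟨p, q, hp⟩ := const (α := ℕ) true
    obtain ⟨p', q', hp'⟩ := const (α := ℕ) false
    refine ⟨.ite .id p' p, .X + q + q' + .X, fun m => ?_⟩
    obtain ⟨s, hs, h0⟩ := hp m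
    obtain ⟨t, ht, h1⟩ := hp' m
    cases m with
    | zero =>
      refine ⟨_, ?_, .ite_false (.id _) h0⟩
      simp only [Polynomial.eval_add, Polynomial.eval_X]
      unfold encSize at *
      omega
    | succ m =>
      refine ⟨_, ?_, .ite_true (.id _) h1⟩
      simp only [Polynomial.eval_add, Polynomial.eval_X]
      unfold encSize at *
      omega
  have h := comp h0 (sub hf hg)
  simpa only [Nat.sub_eq_zero_iff_le] using h

theorem decide_and {p q : γ → Prop} [DecidablePred p] [DecidablePred q]
    (hp : PolyTime (fun c => decide (p c))) (hq : PolyTime (fun c => decide (q c))) :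
    PolyTime (fun c => decide (p c ∧ q c)) := by
  have h := ite hp hq (const false)
  have e : ∀ c, (if p c then decide (q c) else false) = decide (p c ∧ q c) := fun c => by
    by_cases h : p c <;> simp [h]
  simpa only [e] using h

theorem decide_eq {f g : γ → ℕ} (hf : PolyTime f) (hg : PolyTime g) :
    PolyTime (fun c => decide (f c = g c)) := by
  have h := decide_and (decide_le hf hg) (decide_le hg hf)
  simpa only [← le_antisymm_iff] using h

theorem sum {l : γ → List ℕ} (hl : PolyTime l) : PolyTime (fun c => (l c).sum) := by
  have h := foldl (b := fun _ : γ => 0) (f := fun _ (m a : ℕ) => m + a) hl (const 0)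
    (add (fst' snd) (snd' snd)) ⟨.X, fun c b a => by simp; omega⟩
  have e : ∀ l : List ℕ, l.foldl (fun m a => m + a) 0 = l.sum := fun l => by
    rw [List.sum_eq_foldl]
  simpa only [e] using h

theorem foldl_min {l : γ → List ℕ} {f : γ → ℕ} (hl : PolyTime l) (hf : PolyTime f) :
    PolyTime (fun c => (l c).foldl Min.min (f c)) :=
  foldl (f := fun _ (m a : ℕ) => Min.min m a) hl hf
    (min (fst' snd) (snd' snd)) ⟨.X, fun c b a => by simp; omega⟩

theorem range {m : γ → ℕ} (hm : PolyTime m) : PolyTime (fun c => List.range (m c)) := by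
  obtain ⟨P, hP⟩ := hm.size_bound
  -- The new entry is the current length. The cap by `m c` never takes effect, but it bounds the
  -- growth per step in terms of the parameter alone.
  have h := iterate (b := fun _ : γ => ([] : List ℕ))
    (f := fun c l => Min.min l.length (m c) :: l) hm (const _)
    (cons (min (length snd) (comp hm fst)) snd) ⟨P + 1, fun c b => by
      have := hP c
      simp only [encSize_cons, encSize_nat, Polynomial.eval_add, Polynomial.eval_one] at *
      omega⟩
  have e : ∀ r n : ℕ, n ≤ r → (fun l : List ℕ => Min.min l.length r :: l)^[n] [] =
      (List.range n).reverse := fun r n => by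
    induction n with
    | zero => intro _; rfl
    | succ n ih =>
      intro h
      rw [Function.iterate_succ_apply', ih (by omega), List.range_succ]
      simp; omega
  simpa only [e _ _ le_rfl, List.reverse_reverse] using reverse h

/-- Counting up with a flag that toggles at each step, and a counter that advances at every second
one, produces parity and half together. -/
theorem bodd_div2 : PolyTime (fun m : ℕ => (m.bodd, m.div2)) := by
  have h := iterate (γ := ℕ) (b := fun _ => (false, 0))
    (f := fun _ (s : Bool × ℕ) => if s.1 = true then (false, s.2 + 1) else (true, s.2)) id'
    (const _) (ite (by simpa using fst' snd) (pair (const _) (succ (snd' snd)))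
      (pair (const _) (snd' snd))) ⟨8, fun c b => by
      obtain ⟨b, m⟩ := b
      cases b <;> simp [show encSize true = 3 from rfl, show encSize false = 1 from rfl] <;> omega⟩
  have e : ∀ n : ℕ, (fun s : Bool × ℕ => if s.1 = true then (false, s.2 + 1) else (true, s.2))^[n]
      (false, 0) = (n.bodd, n.div2) := fun n => by
    induction n with
    | zero => rfl
    | succ n ih =>
      rw [Function.iterate_succ_apply', ih, Nat.bodd_succ, Nat.div2_succ]
      cases n.bodd <;> rfl
  simpa only [e] using h

theorem bits {f : γ → ℕ} (hf : PolyTime f) : PolyTime (fun c => (f c).bits) := by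
  refine comp (g := Nat.bits) ?_ hf
  have h := iterate (γ := ℕ) (b := fun m => (([] : List Bool), m))
    (f := fun _ (s : List Bool × ℕ) => if s.2 ≤ 0 then s else (s.2.bodd :: s.1, s.2.div2)) id'
    (pair (const _) id') (ite (decide_le (snd' snd) (const 0)) snd
      (pair (cons (fst' (comp bodd_div2 (snd' snd))) (fst' snd))
        (snd' (comp bodd_div2 (snd' snd))))) ⟨8, fun c b => by
      obtain ⟨l, m⟩ := b
      have := encSize_bool_le m.bodd
      have h2 := Nat.bodd_add_div2 m
      split_ifs
      · omega
      · simp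
        omega⟩
  -- Each halving lowers a positive remainder by at least one, so `m` rounds suffice. The digits
  -- already extracted, reversed, followed by those of the remainder `r` are always the digits of
  -- `m`.
  have e : ∀ m n : ℕ, ∃ r, r ≤ m - n ∧ ∃ l : List Bool, l.reverse ++ r.bits = m.bits ∧
      (fun s : List Bool × ℕ => if s.2 ≤ 0 then s else (s.2.bodd :: s.1, s.2.div2))^[n] ([], m) =
        (l, r) := fun m n => by
    induction n with
    | zero => exact ⟨m, le_rfl, [], rfl, rfl⟩
    | succ n ih =>
      obtain ⟨r, hr, l, hl, h⟩ := ih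
      rw [Function.iterate_succ_apply', h]
      rcases Nat.eq_zero_or_pos r with rfl | h0
      · exact ⟨0, Nat.zero_le _, l, hl, rfl⟩
      · have h2 := Nat.bodd_add_div2 r
        refine ⟨r.div2, ?_, r.bodd :: l, ?_, by simp; omega⟩
        · have : 0 < m - n := lt_of_lt_of_le h0 hr
          omega
        · rw [← hl]
          conv_rhs => rw [← Nat.bit_bodd_div2 r]
          -- A vanishing half forces the last digit to be one, since `r` is positive; no leading
          -- zero appears.
          rw [Nat.bits_append_bit _ _ (fun h => by
            cases hb : r.bodd
            · rw [h, hb] at h2; simp at h2; omega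
            · rfl)]
          simp
  have h' := reverse (fst' h)
  convert h' using 2 with m
  obtain ⟨r, hr, l, hl, h⟩ := e m m
  obtain rfl : r = 0 := by omega
  rw [h]
  simpa using hl.symm

end PolyTime
end
end Censored

namespace Censored
open ToData

/-! ## The estimates of the learner -/

/-- The number of observations of item `i` with a threshold of index at least `j`. -/
def obsCount (h : List (List (ℕ × ℕ × ℕ))) (i j : ℕ) : ℕ :=
  (h.flatten.map fun o => if o.1 = i ∧ j ≤ o.2.1 then 1 else 0).sum

/-- The number of those among them that show a value of index at least `j`. -/
def hitCount (h : List (List (ℕ × ℕ × ℕ))) (i j : ℕ) : ℕ :=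
  (h.flatten.map fun o => if (o.1 = i ∧ j ≤ o.2.1) ∧ j ≤ o.2.2 then 1 else 0).sum

/-- The upper confidence bound for a probability of which `S / N` is the empirical estimate, as a
multiple of `1 / M`. -/
def upperBound (M ℓ N S : ℕ) : ℕ :=
  ((List.range M).map fun m =>
    if (m * N - S * M) * (m * N - S * M) ≤ 8 * ℓ * (M * M) * N then 1 else 0).sum

/-- The upper or lower confidence bound. -/
def confBound (up : Bool) (M ℓ N S : ℕ) : ℕ :=
  if up = true then upperBound M ℓ N S else M - upperBound M ℓ N (N - S)

/-- The estimated tail probabilities of item `i`, as multiples of `1 / M`. -/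
def tailWeight (up : Bool) (M ℓ : ℕ) (h : List (List (ℕ × ℕ × ℕ))) (i j : ℕ) : ℕ :=
  ((List.range j).map fun r =>
    confBound up M ℓ (obsCount h i (r + 1)) (hitCount h i (r + 1))).foldl min M

/-- The weight of the value of index `j` of item `i`. -/
def pmfWeight (up : Bool) (k M ℓ : ℕ) (h : List (List (ℕ × ℕ × ℕ))) (i j : ℕ) : ℕ :=
  tailWeight up M ℓ h i j - if j + 1 + 1 ≤ k then tailWeight up M ℓ h i (j + 1) else 0

section
variable {γ : Type*} [ToData γ]

namespace PolyTime

theorem obsCount {h : γ → List (List (ℕ × ℕ × ℕ))} {i j : γ → ℕ} (hh : PolyTime h)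
    (hi : PolyTime i) (hj : PolyTime j) : PolyTime (fun c => obsCount (h c) (i c) (j c)) :=
  sum (map (flatten hh) (ite (decide_and (decide_eq (fst' snd) (comp hi fst))
    (decide_le (comp hj fst) (fst' (snd' snd)))) (const 1) (const 0)))

theorem hitCount {h : γ → List (List (ℕ × ℕ × ℕ))} {i j : γ → ℕ} (hh : PolyTime h)
    (hi : PolyTime i) (hj : PolyTime j) : PolyTime (fun c => hitCount (h c) (i c) (j c)) :=
  sum (map (flatten hh) (ite (decide_and (decide_and (decide_eq (fst' snd) (comp hi fst))
    (decide_le (comp hj fst) (fst' (snd' snd)))) (decide_le (comp hj fst) (snd' (snd' snd))))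
    (const 1) (const 0)))

theorem upperBound {M ℓ N S : γ → ℕ} (hM : PolyTime M) (hℓ : PolyTime ℓ) (hN : PolyTime N)
    (hS : PolyTime S) : PolyTime (fun c => upperBound (M c) (ℓ c) (N c) (S c)) :=
  have hd : PolyTime (fun p : γ × ℕ => p.2 * N p.1 - S p.1 * M p.1) :=
    sub (mul snd (comp hN fst)) (comp (mul hS hM) fst)
  sum (map (range hM) (ite (decide_le (mul hd hd)
    (comp (mul (mul (mul (const 8) hℓ) (mul hM hM)) hN) fst)) (const 1) (const 0)))

theorem confBound (up : Bool) {M ℓ N S : γ → ℕ} (hM : PolyTime M) (hℓ : PolyTime ℓ)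
    (hN : PolyTime N) (hS : PolyTime S) :
    PolyTime (fun c => confBound up (M c) (ℓ c) (N c) (S c)) := by
  cases up
  · exact sub hM (upperBound hM hℓ hN (sub hN hS))
  · exact upperBound hM hℓ hN hS

theorem tailWeight (up : Bool) {M ℓ : γ → ℕ} {h : γ → List (List (ℕ × ℕ × ℕ))} {i j : γ → ℕ}
    (hM : PolyTime M) (hℓ : PolyTime ℓ) (hh : PolyTime h) (hi : PolyTime i) (hj : PolyTime j) :
    PolyTime (fun c => tailWeight up (M c) (ℓ c) (h c) (i c) (j c)) :=
  foldl_min (map (range hj) (confBound up (comp hM fst) (comp hℓ fst)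
    (obsCount (comp hh fst) (comp hi fst) (succ snd))
    (hitCount (comp hh fst) (comp hi fst) (succ snd)))) hM

theorem pmfWeight (up : Bool) {k M ℓ : γ → ℕ} {h : γ → List (List (ℕ × ℕ × ℕ))} {i j : γ → ℕ}
    (hk : PolyTime k) (hM : PolyTime M) (hℓ : PolyTime ℓ) (hh : PolyTime h) (hi : PolyTime i)
    (hj : PolyTime j) :
    PolyTime (fun c => pmfWeight up (k c) (M c) (ℓ c) (h c) (i c) (j c)) :=
  sub (tailWeight up hM hℓ hh hi hj)
    (ite (decide_le (succ (succ hj)) hk) (tailWeight up hM hℓ hh hi (succ hj)) (const 0))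

end PolyTime
end

/-- The estimated distributions in period `t ≤ T`. -/
def learnWeights (up : Bool) (n k T : ℕ) (h : List (List (ℕ × ℕ × ℕ))) (i j : ℕ) : ℕ :=
  -- The grid size `T + 1` is positive even for `T = 0` and exceeds every sample count, so rounding
  -- is finer than the statistical error. The binary length of `k * n * T` is a computable stand-in
  -- for its logarithm.
  pmfWeight up k (T + 1) (k * n * T).bits.length h i j

/-- The input of the learner, except for the state within the period. -/
abbrev LearnInput : Type := (ℕ × ℕ × Data) × ℕ × List (List (ℕ × ℕ × ℕ))

theorem PolyTime.learnWeights (up : Bool) : PolyTime (fun c : LearnInput =>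
    (List.range c.1.1).map fun i => (List.range c.1.2.1).map fun j =>
      (learnWeights up c.1.1 c.1.2.1 c.2.1 c.2.2 i j).bits) :=
  have hn : PolyTime (fun c : LearnInput => c.1.1) := fst' fst
  have hk : PolyTime (fun c : LearnInput => c.1.2.1) := fst' (snd' fst)
  have hT : PolyTime (fun c : LearnInput => c.2.1) := fst' snd
  have hh : PolyTime (fun c : LearnInput => c.2.2) := snd' snd
  have hℓ : PolyTime (fun c : LearnInput => (c.1.2.1 * c.1.1 * c.2.1).bits.length) :=
    length (bits (mul (mul hk hn) hT))
  have lift {β : Type} [ToData β] {f : LearnInput → β} (hf : PolyTime f) :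
      PolyTime (fun p : (LearnInput × ℕ) × ℕ => f p.1.1) := comp hf (fst' fst)
  map (range hn) (map (f := fun (p : LearnInput × ℕ) j =>
      (Censored.learnWeights up p.1.1.1 p.1.1.2.1 p.1.2.1 p.1.2.2 p.2 j).bits)
    (range (comp (g := fun c : LearnInput => c.1.2.1) hk fst))
    (bits (pmfWeight up (lift hk) (succ (lift hT)) (lift hℓ) (lift hh) (snd' fst) snd)))

/-- The program that replaces the feedback by the estimated distributions. -/
theorem PolyTime.learnInput (up : Bool) : PolyTime (fun c : LearnInput × List (ℕ × ℕ × ℕ) =>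
    ((c.1.1, (List.range c.1.1.1).map fun i => (List.range c.1.1.2.1).map fun j =>
      (Censored.learnWeights up c.1.1.1 c.1.1.2.1 c.1.2.1 c.1.2.2 i j).bits), c.2)) :=
  pair (pair (fst' fst) (comp (PolyTime.learnWeights up) fst)) snd

/-! ### Encodings -/

section
variable {n k : ℕ}

/-- An observation as a triple of numbers. -/
def Obs.toNat (o : Obs n k) : ℕ × ℕ × ℕ := (o.1, o.2.1, o.2.2)

theorem encTrace_eq (τ : List (Obs n k)) : encTrace τ = enc (τ.map Obs.toNat) := by
  simp only [encTrace, enc, List.map_map]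
  rfl

theorem encHistory_eq (h : List (List (Obs n k))) :
    encHistory h = enc (h.map fun τ => τ.map Obs.toNat) := by
  simp only [encHistory, enc, List.map_map]
  congr 1
  refine List.map_congr_left fun τ _ => ?_
  simp only [encTrace, List.map_map, Function.comp_apply]
  rfl

theorem encWeights_eq (w : ℕ → ℕ → ℕ) : encWeights (fun (i : Fin n) (j : Fin k) => w i j) =
    enc ((List.range n).map fun i => (List.range k).map fun j => (w i j).bits) := by
  have h1 : ∀ (m : ℕ) {β : Type} (f : ℕ → β),
      List.ofFn (fun i : Fin m => f i) = (List.range m).map f := fun m β f => by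
    apply List.ext_getElem <;> simp
  have h2 : ∀ m, Data.binary m = enc m.bits := fun m => rfl
  have h3 : encWeights (fun (i : Fin n) (j : Fin k) => w i j) = Data.ofList ((List.range n).map
      fun i => Data.ofList ((List.range k).map fun j => enc (w i j).bits)) := by
    rw [← h1]
    simp only [← h1]
    rfl
  rw [h3]
  simp only [enc, List.map_map]
  congr 1
  refine List.map_congr_left fun i _ => ?_
  simp only [List.map_map, Function.comp_apply]
  rfl

theorem Instance.code_eq (I : Instance) : I.code = enc (I.n, I.k, I.param) := rfl

end

end Censored

namespace Censored
open ToData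

/-! ## The program of the learner -/

section
variable {n k : ℕ}

namespace Policy

theorem length_trace_le {σ : Policy n k} (hσ : σ.ProbesOnce) (x : Fin n → Fin k) :
    (σ.trace x).length ≤ n := by
  have := (hσ x).length_le_card
  simpa [trace] using this

/-- At the nodes of a policy that never probes an item twice, at most `n` probes were made. -/
theorem Implements.imp_of_length_le {act act' : List (Obs n k) → Option (Fin n × Fin k) → Prop}
    (H : ∀ τ d, τ.length ≤ n → act τ d → act' τ d) (σ : Policy n k) : ∀ τ : List (Obs n k),
    (∃ x : Fin n → Fin k, ∀ o ∈ τ, o.2.2 = min (x o.1) o.2.1) →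
    (∀ x : Fin n → Fin k, (∀ o ∈ τ, o.2.2 = min (x o.1) o.2.1) →
      (τ.map Prod.fst ++ (σ.probes x).map Prod.fst).Nodup) →
    σ.Implements act τ → σ.Implements act' τ := by
  induction σ with
  | leaf =>
    rintro τ ⟨x, hx⟩ hτ h
    have := (List.nodup_append.1 (hτ x hx)).1.length_le_card
    exact H _ _ (by simpa using this) h
  | probe i c next ih =>
    rintro τ ⟨x, hx⟩ hτ ⟨h, h'⟩
    have h1 := List.nodup_append.1 (hτ x hx)
    have := h1.1.length_le_card
    -- Item `i` has not been probed before, so changing its value keeps the earlier observations and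
    -- makes the longer state realizable. Realizability is needed because the hypothesis on repeated
    -- probes concerns actual executions only.
    refine ⟨H _ _ (by simpa using this) h, fun j => ih j _ ⟨Function.update x i j, ?_⟩ ?_ (h' j)⟩
    · intro o ho
      rcases List.mem_append.1 ho with ho | ho
      · have hne : o.1 ≠ i := h1.2.2 _ (List.mem_map_of_mem ho) _ (by simp [probes])
        rw [Function.update_of_ne hne, hx o ho]
      · obtain rfl := List.mem_singleton.1 ho
        simp only [Function.update_self]
        exact (min_eq_left (Set.mem_Iic.1 j.2)).symm
    · intro y hy
      have h2 := hτ y fun o ho => hy o (List.mem_append_left _ ho)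
      have h3 : j = ⟨min (y i) c, Set.mem_Iic.2 (min_le_right _ _)⟩ :=
        Subtype.ext (hy (i, c, j.1) (by simp))
      rw [h3]
      simpa [probes] using h2

theorem Implements.imp {act act' : List (Obs n k) → Option (Fin n × Fin k) → Prop}
    (H : ∀ τ d, τ.length ≤ n → act τ d → act' τ d) (hk : 0 < k) {σ : Policy n k}
    (hσ : σ.ProbesOnce) (h : σ.Implements act []) : σ.Implements act' [] :=
  imp_of_length_le H σ [] ⟨fun _ => ⟨0, hk⟩, by simp⟩ (fun x _ => by simpa using hσ x) h

end Policy

/-- The feedback with indices as natural numbers. -/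
def natHistory (h : List (List (Obs n k))) : List (List (ℕ × ℕ × ℕ)) :=
  h.map fun τ => τ.map Obs.toNat

theorem encSize_trace_le {τ : List (Obs n k)} (hτ : τ.length ≤ n) {B : ℕ}
    (hB : 2 * n + 4 * k + 5 ≤ B) : encSize (τ.map Obs.toNat) ≤ n * (B + 1) + 1 := by
  have h := encSize_le_of_forall (l := τ.map Obs.toNat) (B := B) fun o ho => by
    obtain ⟨o, -, rfl⟩ := List.mem_map.1 ho
    have h1 := o.1.2
    have h2 := o.2.1.2
    have h3 := o.2.2.2
    simp only [Obs.toNat, encSize_pair, encSize_nat]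
    omega
  refine h.trans ?_
  rw [List.length_map]
  gcongr

end

/-- The estimated distributions of an instance, as weights. -/
def Instance.estimate (I : Instance) (up : Bool) (T : ℕ) (h : List (List (Obs I.n I.k))) :
    Fin I.n → Fin I.k → ℕ :=
  fun i j => learnWeights up I.n I.k T (natHistory h) i j

/-- Composition of the estimation of the distributions with an algorithm for known distributions. -/
theorem exists_learner (up : Bool) (A : Prog) (q : Polynomial ℕ) :
    ∃ (L : Prog) (q' : Polynomial ℕ), ∀ (I : Instance) (T : ℕ) (h : List (List (Obs I.n I.k)))
      (σ : Policy I.n I.k), h.length ≤ T → (∀ τ ∈ h, τ.length ≤ I.n) → σ.ProbesOnce →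
      ComputesPolicy A (.pair I.code (encWeights (I.estimate up T h)))
        (q.eval (I.code.size + (encWeights (I.estimate up T h)).size)) σ →
      ComputesPolicy L (.pair I.code (.pair (.unary T) (encHistory h)))
        (q'.eval (I.code.size + T)) σ := by
  obtain ⟨p, r, hp⟩ := PolyTime.learnInput up
  -- `Y` bounds the encoding of the feedback of one period, and `Z` that of the whole input of the
  -- estimation program.
  let Y : Polynomial ℕ := .X * (2 * .X + 6) + 1
  let Z : Polynomial ℕ := 3 * .X + .X * (Y + 1) + Y + 5
  refine ⟨.seq p A, r.comp Z + q.comp (r.comp Z) + Z, fun I T h σ hT hh hσ hA => ?_⟩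
  refine Policy.Implements.imp ?_ I.k_pos hσ hA
  rintro τ d hτ ⟨t, ht, hrun⟩
  obtain ⟨s, hs, hr⟩ := hp (((I.n, I.k, I.param), T, natHistory h), τ.map Obs.toNat)
  unfold Instance.estimate at hrun ht
  simp only [encWeights_eq, encTrace_eq] at hrun ht ⊢
  have hcode : encSize (I.n, I.k, I.param) = I.code.size := rfl
  have hn : 2 * I.n + 2 * I.k ≤ I.code.size := by
    rw [← hcode]
    simp only [encSize_pair, encSize_nat]
    omega
  have hY : ∀ τ : List (Obs I.n I.k), τ.length ≤ I.n →
      encSize (τ.map Obs.toNat) ≤ Y.eval (I.code.size + T) := fun τ hτ => by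
    refine (encSize_trace_le hτ (B := 2 * (I.code.size + T) + 5) (by omega)).trans ?_
    simp only [Y, Polynomial.eval_add, Polynomial.eval_mul, Polynomial.eval_X,
      Polynomial.eval_one, Polynomial.eval_ofNat]
    exact Nat.add_le_add_right (Nat.mul_le_mul (by omega) le_rfl) 1
  have hτ' := hY τ hτ
  have hh' : encSize (natHistory h) ≤ (I.code.size + T) * (Y.eval (I.code.size + T) + 1) + 1 := by
    refine (encSize_le_of_forall (B := Y.eval (I.code.size + T)) fun τ hτ => ?_).trans ?_
    · obtain ⟨τ', hτ', rfl⟩ := List.mem_map.1 hτ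
      exact hY τ' (hh τ' hτ')
    · rw [natHistory, List.length_map]
      exact Nat.add_le_add_right (Nat.mul_le_mul (by omega) le_rfl) 1
  have hZ : encSize (((I.n, I.k, I.param), T, natHistory h), τ.map Obs.toNat) ≤
      Z.eval (I.code.size + T) := by
    rw [encSize_pair, encSize_pair, hcode, encSize_pair, encSize_nat]
    simp only [Z, Polynomial.eval_add, Polynomial.eval_mul, Polynomial.eval_X,
      Polynomial.eval_one, Polynomial.eval_ofNat]
    omega
  have hs' : s ≤ r.eval (Z.eval (I.code.size + T)) := hs.trans (eval_mono r hZ)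
  have h2 := hr.size_le
  -- The time of `A` is polynomial in the length of its own input. That input is part of the output
  -- of the estimation program, hence no longer than the running time of the latter.
  have h3 : t ≤ q.eval (r.eval (Z.eval (I.code.size + T))) := by
    refine ht.trans (eval_mono q ?_)
    refine le_trans ?_ (h2.trans hs')
    simp only [enc, Data.size]
    rw [Instance.code_eq]
    simp only [enc, Data.size]
    unfold learnWeights
    omega
  refine ⟨s + t + _, ?_, .seq (y := .pair (.pair I.code _) _) ?_ hrun⟩
  · rw [encHistory_eq]
    simp only [Polynomial.eval_add, Polynomial.eval_comp]
    exact Nat.add_le_add (Nat.add_le_add hs' h3) hZ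
  · rw [encHistory_eq]
    exact hr

end Censored

namespace Censored

/-! ## Expectations over the executions of a policy -/

section
variable {n k : ℕ}

namespace Policy

/-- An execution never looks at an item that it does not probe. This is the independence used when
conditioning on the first probe. -/
theorem probes_update {σ : Policy n k} {x : Fin n → Fin k} {i : Fin n}
    (h : i ∉ (σ.probes x).map Prod.fst) (v : Fin k) :
    σ.probes (Function.update x i v) = σ.probes x := by
  induction σ with
  | leaf => rfl
  | probe i' c next ih =>
    simp only [probes, List.map_cons, List.mem_cons, not_or] at h ⊢
    simp only [Function.update_of_ne (Ne.symm h.1), ih _ h.2]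

theorem trace_update {σ : Policy n k} {x : Fin n → Fin k} {i : Fin n}
    (h : i ∉ (σ.probes x).map Prod.fst) (v : Fin k) :
    σ.trace (Function.update x i v) = σ.trace x := by
  rw [trace, probes_update h, trace]
  refine List.map_congr_left fun p hp => ?_
  have hne : p.1 ≠ i := fun e => h (e ▸ List.mem_map_of_mem hp)
  rw [Function.update_of_ne hne]

theorem trace_probe (i : Fin n) (c : Fin k) (next : Set.Iic c → Policy n k) (x : Fin n → Fin k) :
    (probe i c next).trace x = (i, c, min (x i) c) ::
      (next ⟨min (x i) c, Set.mem_Iic.2 (min_le_right _ _)⟩).trace x := rfl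

section
variable {i : Fin n} {c : Fin k} {next : Set.Iic c → Policy n k}

/-- Giving item `i` the value `j` steers the execution into the child `j`, whatever the other values
are. As that child then never probes `i`, the artificial value can be removed again in the lemmas
below. -/
theorem ProbesOnce.nodup_update (h : (probe i c next).ProbesOnce) (j : Set.Iic c)
    (x : Fin n → Fin k) :
    i ∉ ((next j).probes (Function.update x i j.1)).map Prod.fst ∧
      (((next j).probes (Function.update x i j.1)).map Prod.fst).Nodup := by
  have h1 := h (Function.update x i j.1)
  have h2 : (⟨min (Function.update x i j.1 i) c, Set.mem_Iic.2 (min_le_right _ _)⟩ : Set.Iic c) = j :=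
    Subtype.ext (by rw [Function.update_self]; exact min_eq_left (Set.mem_Iic.1 j.2))
  simpa only [probes, h2, List.map_cons, List.nodup_cons] using h1

theorem ProbesOnce.probes_next (h : (probe i c next).ProbesOnce) (j : Set.Iic c)
    (x : Fin n → Fin k) :
    (next j).probes (Function.update x i j.1) = (next j).probes x := by
  have h1 := probes_update (h.nodup_update j x).1 (x i)
  rwa [Function.update_idem, Function.update_eq_self, eq_comm] at h1

theorem ProbesOnce.notMem_next (h : (probe i c next).ProbesOnce) (j : Set.Iic c)
    (x : Fin n → Fin k) : i ∉ ((next j).probes x).map Prod.fst := by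
  rw [← h.probes_next j x]
  exact (h.nodup_update j x).1

theorem ProbesOnce.child (h : (probe i c next).ProbesOnce) (j : Set.Iic c) :
    (next j).ProbesOnce := fun x => by
  rw [← h.probes_next j x]
  exact (h.nodup_update j x).2

end

end Policy

/-- The expectation under the product distribution `D`. -/
noncomputable def pexp (D : Fin n → Fin k → ℝ) (F : (Fin n → Fin k) → ℝ) : ℝ :=
  ∑ x, prob D x * F x

section
variable {D E : Fin n → Fin k → ℝ}

theorem prob_nonneg (hD : IsDist D) (x : Fin n → Fin k) : 0 ≤ prob D x :=
  Finset.prod_nonneg fun i _ => (hD i).1 _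

theorem sum_prob (hD : IsDist D) : ∑ x, prob D x = 1 := by
  unfold prob
  rw [← Fintype.piFinset_univ, ← Finset.prod_univ_sum]
  exact Finset.prod_eq_one fun i _ => (hD i).2

theorem pexp_const (hD : IsDist D) (r : ℝ) : pexp D (fun _ => r) = r := by
  rw [pexp, ← Finset.sum_mul, sum_prob hD, one_mul]

theorem pexp_mono (hD : IsDist D) {F G : (Fin n → Fin k) → ℝ} (h : ∀ x, F x ≤ G x) :
    pexp D F ≤ pexp D G :=
  Finset.sum_le_sum fun x _ => mul_le_mul_of_nonneg_left (h x) (prob_nonneg hD x)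

theorem pexp_add (F G : (Fin n → Fin k) → ℝ) :
    pexp D (fun x => F x + G x) = pexp D F + pexp D G := by
  simp only [pexp, mul_add, Finset.sum_add_distrib]

theorem pexp_const_mul (r : ℝ) (F : (Fin n → Fin k) → ℝ) :
    pexp D (fun x => r * F x) = r * pexp D F := by
  simp only [pexp, Finset.mul_sum]
  exact Finset.sum_congr rfl fun x _ => by ring

theorem mul_prob_update (i : Fin n) (x : Fin n → Fin k) (v : Fin k) :
    D i (x i) * prob D (Function.update x i v) = D i v * prob D x := by
  unfold prob
  rw [← Finset.mul_prod_erase _ _ (Finset.mem_univ i),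
    ← Finset.mul_prod_erase _ (fun j => D j (x j)) (Finset.mem_univ i), Function.update_self]
  have : ∏ j ∈ Finset.univ.erase i, D j (Function.update x i v j) =
      ∏ j ∈ Finset.univ.erase i, D j (x j) :=
    Finset.prod_congr rfl fun j hj => by rw [Function.update_of_ne (Finset.ne_of_mem_erase hj)]
  rw [this]
  ring

/-- Drawing a coordinate anew does not change the distribution. -/
theorem pexp_resample (hD : IsDist D) (i : Fin n) (F : (Fin n → Fin k) → ℝ) :
    pexp D F = ∑ v, D i v * pexp D (fun x => F (Function.update x i v)) := by
  have h1 : ∀ v : Fin k, D i v * pexp D (fun x => F (Function.update x i v)) =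
      ∑ x, D i v * prob D x * F (Function.update x i v) := fun v => by
    rw [pexp, Finset.mul_sum]
    exact Finset.sum_congr rfl fun x _ => by ring
  have h2 : pexp D F = ∑ v, ∑ x, D i v * prob D x * F x := by
    simp only [mul_assoc, ← Finset.mul_sum]
    rw [← Finset.sum_mul, (hD i).2, one_mul, pexp]
  simp only [h1]
  rw [h2, ← Fintype.sum_prod_type', ← Fintype.sum_prod_type']
  -- Exchanging the fresh value with the old coordinate is an involution that preserves the joint
  -- weight, by `mul_prob_update`.
  refine Fintype.sum_bijective (fun p : Fin k × (Fin n → Fin k) => (p.2 i, Function.update p.2 i p.1))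
    (Function.Involutive.bijective fun p => by simp) _ _ fun p => ?_
  simp only [mul_prob_update, Function.update_idem, Function.update_eq_self]

/-- Conditioning on the outcome of the first probe. -/
theorem pexp_trace_probe (hD : IsDist D) {i : Fin n} {c : Fin k} {next : Set.Iic c → Policy n k}
    (h : (Policy.probe i c next).ProbesOnce) (g : List (Obs n k) → ℝ) :
    pexp D (fun x => g ((Policy.probe i c next).trace x)) =
      ∑ v, D i v * pexp D (fun x => g ((i, c, min v c) ::
        (next ⟨min v c, Set.mem_Iic.2 (min_le_right _ _)⟩).trace x)) := by
  rw [pexp_resample hD i]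
  refine Finset.sum_congr rfl fun v _ => ?_
  congr 2
  funext x
  rw [Policy.trace_probe]
  simp only [Function.update_self]
  rw [Policy.trace_update (h.notMem_next _ x)]

/-- Products of factors of conditional expectation at most one. -/
theorem pexp_prod_trace_le_one (hD : IsDist D) {ψ : Obs n k → ℝ} (h0 : ∀ o, 0 ≤ ψ o)
    (h1 : ∀ i c, ∑ v, D i v * ψ (i, c, min v c) ≤ 1) (σ : Policy n k) (hσ : σ.ProbesOnce) :
    pexp D (fun x => ((σ.trace x).map ψ).prod) ≤ 1 := by
  induction σ with
  | leaf => exact (pexp_const hD 1).le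
  | probe i c next ih =>
    rw [pexp_trace_probe hD hσ fun τ => (τ.map ψ).prod]
    refine le_trans (Finset.sum_le_sum fun v _ => ?_) (h1 i c)
    simp only [List.map_cons, List.prod_cons, pexp_const_mul]
    exact mul_le_mul_of_nonneg_left (mul_le_of_le_one_right (h0 _) (ih _ (hσ.child _))) ((hD i).1 v)

/-- Stability: under another distribution the expectation of a function of the execution changes
by at most the expected sum of the distances of the distributions of the observations. -/
theorem abs_pexp_sub_pexp_le (hD : IsDist D) (hE : IsDist E) {B : ℝ} {d : Fin n → Fin k → ℝ}
    (hd : ∀ i c (φ : Fin k → ℝ), (∀ v, 0 ≤ φ v) → (∀ v, φ v ≤ B) →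
      |∑ v, (E i v - D i v) * φ (min v c)| ≤ B * d i c)
    (σ : Policy n k) (hσ : σ.ProbesOnce) : ∀ g : List (Obs n k) → ℝ, (∀ τ, 0 ≤ g τ) →
      (∀ τ, g τ ≤ B) →
      |pexp E (fun x => g (σ.trace x)) - pexp D (fun x => g (σ.trace x))| ≤
        B * pexp D (fun x => ((σ.trace x).map fun o => d o.1 o.2.1).sum) := by
  induction σ with
  | leaf =>
    intro g _ _
    simp [Policy.trace, Policy.probes, pexp_const hD, pexp_const hE]
  | probe i c next ih =>
    intro g h0 h1
    rw [pexp_trace_probe hD hσ, pexp_trace_probe hE hσ,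
      pexp_trace_probe hD hσ fun τ => (τ.map fun o => d o.1 o.2.1).sum]
    simp only [List.map_cons, List.sum_cons, pexp_add, pexp_const hD]
    -- The continuation is extended by an irrelevant leaf to indices above `c`, so that its value
    -- becomes a function `φ` on all of `Fin k`.
    let next' : Fin k → Policy n k := fun v => if h : v ≤ c then next ⟨v, h⟩ else .leaf
    have hn : ∀ v, next ⟨min v c, Set.mem_Iic.2 (min_le_right _ _)⟩ = next' (min v c) := fun v => by
      simp only [next']
      rw [dif_pos (min_le_right _ _)]
    let φ : Fin k → ℝ := fun v => pexp E fun x => g ((i, c, v) :: (next' v).trace x)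
    have hφ0 : ∀ v, 0 ≤ φ v := fun v => by
      rw [← pexp_const hE 0]
      exact pexp_mono hE fun x => h0 _
    have hφ1 : ∀ v, φ v ≤ B := fun v => by
      rw [← pexp_const hE B]
      exact pexp_mono hE fun x => h1 _
    have e1 := hd i c φ hφ0 hφ1
    have e2 : ∀ v, |φ (min v c) - pexp D (fun x => g ((i, c, min v c) ::
        (next ⟨min v c, Set.mem_Iic.2 (min_le_right _ _)⟩).trace x))| ≤ B * pexp D (fun x =>
          (((next ⟨min v c, Set.mem_Iic.2 (min_le_right _ _)⟩).trace x).map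
            fun o => d o.1 o.2.1).sum) := fun v => by
      have := ih ⟨min v c, Set.mem_Iic.2 (min_le_right _ _)⟩ (hσ.child _)
        (fun τ => g ((i, c, min v c) :: τ)) (fun τ => h0 _) (fun τ => h1 _)
      simpa only [φ, ← hn] using this
    simp only [mul_add, Finset.sum_add_distrib, ← Finset.sum_mul, (hD i).2, one_mul]
    -- Hybrid step: change the law of the first observation while the continuation is valued under
    -- `E`, then change the law of the continuation with the first outcome drawn from `D`. The first
    -- error is bounded by `e1`, the second by induction.
    have e3 : ∑ v, E i v * pexp E (fun x => g ((i, c, min v c) ::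
          (next ⟨min v c, Set.mem_Iic.2 (min_le_right _ _)⟩).trace x)) -
        ∑ v, D i v * pexp D (fun x => g ((i, c, min v c) ::
          (next ⟨min v c, Set.mem_Iic.2 (min_le_right _ _)⟩).trace x)) =
        ∑ v, (E i v - D i v) * φ (min v c) + ∑ v, D i v * (φ (min v c) - pexp D (fun x =>
          g ((i, c, min v c) ::
            (next ⟨min v c, Set.mem_Iic.2 (min_le_right _ _)⟩).trace x))) := by
      rw [← Finset.sum_add_distrib, ← Finset.sum_sub_distrib]
      refine Finset.sum_congr rfl fun v _ => ?_
      simp only [φ, ← hn]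
      ring
    rw [e3, Finset.mul_sum]
    refine (abs_add_le _ _).trans (add_le_add e1 ((Finset.abs_sum_le_sum_abs _ _).trans
      (Finset.sum_le_sum fun v _ => ?_)))
    rw [abs_mul, abs_of_nonneg ((hD i).1 v), mul_left_comm]
    exact mul_le_mul_of_nonneg_left (e2 v) ((hD i).1 v)

/-- The probability that item `i` has a value of index at least `m`. -/
noncomputable def tail (D : Fin n → Fin k → ℝ) (i : Fin n) (m : ℕ) : ℝ :=
  ∑ v : Fin k, if m ≤ (v : ℕ) then D i v else 0

/-- The distance of two distributions of the observation of a probe in terms of tails. -/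
theorem abs_sum_sub_mul_min_le (hD : IsDist D) (hE : IsDist E) {B : ℝ} (i : Fin n) (c : Fin k)
    (φ : Fin k → ℝ) (h0 : ∀ v, 0 ≤ φ v) (h1 : ∀ v, φ v ≤ B) :
    |∑ v, (E i v - D i v) * φ (min v c)| ≤
      B * ∑ r ∈ Finset.range c, |tail E i (r + 1) - tail D i (r + 1)| := by
  have hk : 0 < k := c.pos
  let Φ : ℕ → ℝ := fun m => φ ⟨min m (k - 1), by omega⟩
  have hΦ : ∀ v : Fin k, φ v = Φ v := fun v => by
    simp only [Φ]
    congr 1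
    ext
    have := v.2
    simp only
    omega
  -- Summation by parts: writing `φ` as a sum of its increments turns the difference of expectations
  -- into a combination of tail differences, with coefficients of size at most `B`. Censoring at `c`
  -- stops the sum there.
  have hsum : ∀ v : Fin k, φ (min v c) = Φ 0 + ∑ r ∈ Finset.range c,
      if r + 1 ≤ (v : ℕ) then Φ (r + 1) - Φ r else 0 := fun v => by
    rw [← Finset.sum_filter]
    have : (Finset.range (c : ℕ)).filter (fun r => r + 1 ≤ (v : ℕ)) =
        Finset.range (min (v : ℕ) (c : ℕ)) := by
      ext r; simp only [Finset.mem_filter, Finset.mem_range]; omega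
    have hm : ((min v c : Fin k) : ℕ) = min (v : ℕ) (c : ℕ) := by
      rcases le_total v c with h | h
      · rw [min_eq_left h, min_eq_left (Fin.le_def.1 h)]
      · rw [min_eq_right h, min_eq_right (Fin.le_def.1 h)]
    rw [this, Finset.sum_range_sub, hΦ, hm]
    ring
  have e : ∑ v, (E i v - D i v) * φ (min v c) = ∑ r ∈ Finset.range c,
      (Φ (r + 1) - Φ r) * (tail E i (r + 1) - tail D i (r + 1)) := by
    simp only [hsum, mul_add, Finset.sum_add_distrib, ← Finset.sum_mul, Finset.sum_sub_distrib,
      (hD i).2, (hE i).2, sub_self, zero_mul, zero_add, Finset.mul_sum]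
    rw [Finset.sum_comm]
    refine Finset.sum_congr rfl fun r _ => ?_
    simp only [tail, ← Finset.sum_sub_distrib, Finset.mul_sum]
    refine Finset.sum_congr rfl fun v _ => ?_
    split_ifs <;> ring
  rw [e, Finset.mul_sum]
  refine (Finset.abs_sum_le_sum_abs _ _).trans (Finset.sum_le_sum fun r _ => ?_)
  rw [abs_mul]
  refine mul_le_mul_of_nonneg_right ?_ (abs_nonneg _)
  rw [abs_le]
  constructor <;> linarith [h0 ⟨min (r + 1) (k - 1), by omega⟩, h0 ⟨min r (k - 1), by omega⟩,
    h1 ⟨min (r + 1) (k - 1), by omega⟩, h1 ⟨min r (k - 1), by omega⟩]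

end
end
end Censored

namespace Censored

/-! ## Expectations over successive periods -/

section
variable {n k : ℕ} {D : Fin n → Fin k → ℝ}

/-- The expectation of a function of the realizations of the first `t` periods. -/
noncomputable def listExp (D : Fin n → Fin k → ℝ) : ℕ → (List (Fin n → Fin k) → ℝ) → ℝ
  | 0, F => F []
  | t + 1, F => listExp D t fun l => pexp D fun x => F (l ++ [x])

theorem listExp_mono (hD : IsDist D) (t : ℕ) : ∀ {F G : List (Fin n → Fin k) → ℝ},
    (∀ l, l.length = t → F l ≤ G l) → listExp D t F ≤ listExp D t G := by
  induction t with
  | zero => exact fun h => h [] rfl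
  | succ t ih => exact fun h => ih fun l hl => pexp_mono hD fun x => h _ (by simp [hl])

theorem listExp_add (t : ℕ) : ∀ F G : List (Fin n → Fin k) → ℝ,
    listExp D t (fun l => F l + G l) = listExp D t F + listExp D t G := by
  induction t with
  | zero => exact fun _ _ => rfl
  | succ t ih => intro F G; simp only [listExp, pexp_add, ih]

theorem listExp_const_mul (t : ℕ) (r : ℝ) : ∀ F : List (Fin n → Fin k) → ℝ,
    listExp D t (fun l => r * F l) = r * listExp D t F := by
  induction t with
  | zero => exact fun _ => rfl
  | succ t ih => intro F; simp only [listExp, pexp_const_mul, ih]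

theorem listExp_const (hD : IsDist D) (t : ℕ) (r : ℝ) : listExp D t (fun _ => r) = r := by
  induction t with
  | zero => rfl
  | succ t ih => simp only [listExp, pexp_const hD, ih]

theorem listExp_sum {ι : Type*} (t : ℕ) (s : Finset ι) (F : ι → List (Fin n → Fin k) → ℝ) :
    listExp D t (fun l => ∑ i ∈ s, F i l) = ∑ i ∈ s, listExp D t (F i) := by
  classical
  induction s using Finset.induction_on with
  | empty =>
    have := listExp_const_mul (D := D) t 0 fun _ => 0
    simpa using this
  | insert a s ha ih => simp only [Finset.sum_insert ha, listExp_add, ih]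

theorem sum_ofFn_eq_listExp (T : ℕ) : ∀ F : List (Fin n → Fin k) → ℝ,
    ∑ xs : Fin T → Fin n → Fin k, (∏ t, prob D (xs t)) * F (List.ofFn xs) = listExp D T F := by
  induction T with
  | zero => intro F; simp [listExp]
  | succ T ih =>
    intro F
    rw [listExp, ← ih, ← (Fin.snocEquiv fun _ : Fin (T + 1) => Fin n → Fin k).sum_comp,
      Fintype.sum_prod_type, Finset.sum_comm]
    refine Finset.sum_congr rfl fun xs _ => ?_
    rw [pexp, Finset.mul_sum]
    refine Finset.sum_congr rfl fun x _ => ?_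
    rw [Fin.prod_univ_castSucc, List.ofFn_succ', List.concat_eq_append]
    simp only [Fin.snocEquiv_apply, Fin.snoc_castSucc, Fin.snoc_last]
    ring

/-- The expected total cost, period by period. -/
theorem sum_sum_take_eq (hD : IsDist D) (c : List (Fin n → Fin k) → (Fin n → Fin k) → ℝ) (T : ℕ) :
    ∑ xs : Fin T → Fin n → Fin k, (∏ t, prob D (xs t)) *
      ∑ t : Fin T, c ((List.ofFn xs).take t) (xs t) =
        ∑ t ∈ Finset.range T, listExp D t fun l => pexp D (c l) := by
  induction T with
  | zero => simp
  | succ T ih =>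
    rw [Finset.sum_range_succ, ← ih, ← sum_ofFn_eq_listExp, ← Finset.sum_add_distrib,
      ← (Fin.snocEquiv fun _ : Fin (T + 1) => Fin n → Fin k).sum_comp,
      Fintype.sum_prod_type, Finset.sum_comm]
    refine Finset.sum_congr rfl fun xs _ => ?_
    have e1 : ∀ (x : Fin n → Fin k) (t : ℕ), t ≤ T →
        (List.ofFn (Fin.snocEquiv (fun _ : Fin (T + 1) => Fin n → Fin k) (x, xs))).take t =
          (List.ofFn xs).take t := fun x t ht => by
      rw [List.ofFn_succ', List.concat_eq_append]
      simp only [Fin.snocEquiv_apply, Fin.snoc_castSucc]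
      rw [List.take_append_of_le_length (by simpa using ht)]
    have e2 : (List.ofFn xs).take T = List.ofFn xs := List.take_of_length_le (by simp)
    simp only [Fin.sum_univ_castSucc, Fin.prod_univ_castSucc, Fin.val_castSucc, Fin.val_last,
      e1 _ _ le_rfl, e2, fun x (t : Fin T) => e1 x t t.2.le]
    simp only [Fin.snocEquiv_apply, Fin.snoc_castSucc, Fin.snoc_last]
    simp only [mul_add, Finset.sum_add_distrib, pexp, Finset.mul_sum]
    rw [Finset.sum_comm]
    congr 1
    · refine Finset.sum_congr rfl fun t _ => ?_
      rw [← Finset.sum_mul, ← Finset.mul_sum, sum_prob hD, mul_one]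
    · exact Finset.sum_congr rfl fun x _ => by ring

theorem Instance.expectedTotal_eq (I : Instance) {D : Fin I.n → Fin I.k → ℝ} (hD : IsDist D)
    (T : ℕ) (S : Strategy I.n I.k) : I.expectedTotal D T S =
      ∑ t ∈ Finset.range T, listExp D t fun l => I.expected D (S (S.history l)) :=
  sum_sum_take_eq hD (fun l x => I.f (S (S.history l)) x) T

theorem Strategy.history_append (S : Strategy n k) (l : List (Fin n → Fin k)) (x : Fin n → Fin k) :
    S.history (l ++ [x]) = S.history l ++ [(S (S.history l)).trace x] := by
  simp [Strategy.history]

theorem Strategy.history_induction (S : Strategy n k) {p : List (List (Obs n k)) → Prop}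
    (h0 : p []) (h1 : ∀ h x, p h → p (h ++ [(S h).trace x])) (l : List (Fin n → Fin k)) :
    p (S.history l) := by
  induction l using List.reverseRecOn with
  | nil => exact h0
  | append_singleton l x ih => rw [S.history_append]; exact h1 _ _ ih

theorem Strategy.length_history (S : Strategy n k) (l : List (Fin n → Fin k)) :
    (S.history l).length = l.length := by
  induction l using List.reverseRecOn with
  | nil => rfl
  | append_singleton l x ih => simp [S.history_append, ih]

/-! ### Concentration of the counts -/

/-- The contribution of an observation to `obsCount`. -/
def obsInd (i : Fin n) (j : ℕ) (o : Obs n k) : ℕ := if o.1 = i ∧ j ≤ (o.2.1 : ℕ) then 1 else 0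

/-- The contribution of an observation to `hitCount`. -/
def hitInd (i : Fin n) (j : ℕ) (o : Obs n k) : ℕ :=
  if (o.1 = i ∧ j ≤ (o.2.1 : ℕ)) ∧ j ≤ (o.2.2 : ℕ) then 1 else 0

theorem obsCount_natHistory (h : List (List (Obs n k))) (i : Fin n) (j : ℕ) :
    obsCount (natHistory h) i j = (h.flatten.map (obsInd i j)).sum := by
  rw [obsCount, natHistory, ← List.map_flatten, List.map_map]
  simp only [Function.comp_def, Obs.toNat, Fin.val_inj]
  rfl

theorem hitCount_natHistory (h : List (List (Obs n k))) (i : Fin n) (j : ℕ) :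
    hitCount (natHistory h) i j = (h.flatten.map (hitInd i j)).sum := by
  rw [hitCount, natHistory, ← List.map_flatten, List.map_map]
  simp only [Function.comp_def, Obs.toNat, Fin.val_inj]
  rfl

/-- For a centred variable the linear term has mean zero, so this bounds a moment generating
function by a purely quadratic exponential. -/
theorem exp_le_add_exp_sq (y : ℝ) : Real.exp y ≤ y + Real.exp (y ^ 2) := by
  have h1 := Real.add_one_le_exp (y ^ 2)
  rcases lt_or_ge y (-1) with h | h
  · have : Real.exp y ≤ 1 := Real.exp_le_one_iff.2 (by linarith)
    nlinarith
  · rcases lt_or_ge 1 y with h' | h'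
    · have : Real.exp y ≤ Real.exp (y ^ 2) := Real.exp_le_exp.2 (by nlinarith)
      linarith
    · have := (abs_le.1 (Real.abs_exp_sub_one_sub_id_le (abs_le.2 ⟨h, h'⟩))).2
      linarith

/-- The moment generating function of a centred indicator. -/
theorem sum_mul_exp_le (hD : IsDist D) (i : Fin n) (j : ℕ) (s : ℝ) :
    ∑ v : Fin k, D i v * Real.exp (s * ((if j ≤ (v : ℕ) then 1 else 0) - tail D i j)) ≤
      Real.exp (s ^ 2) := by
  have h0 : 0 ≤ tail D i j := Finset.sum_nonneg fun v _ => by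
    split_ifs
    exacts [(hD i).1 v, le_rfl]
  have h1 : tail D i j ≤ 1 := by
    rw [← (hD i).2]
    refine Finset.sum_le_sum fun v _ => ?_
    split_ifs
    exacts [le_rfl, (hD i).1 v]
  calc _ ≤ ∑ v : Fin k, (s * (D i v * (if j ≤ (v : ℕ) then 1 else 0) - D i v * tail D i j) +
        D i v * Real.exp (s ^ 2)) := Finset.sum_le_sum fun v _ => by
        have h2 := exp_le_add_exp_sq (s * ((if j ≤ (v : ℕ) then 1 else 0) - tail D i j))
        have h3 : Real.exp ((s * ((if j ≤ (v : ℕ) then 1 else 0) - tail D i j)) ^ 2) ≤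
            Real.exp (s ^ 2) := Real.exp_le_exp.2 (by
          rw [mul_pow]
          refine mul_le_of_le_one_right (sq_nonneg s) ?_
          split_ifs <;> nlinarith)
        have h4 := mul_le_mul_of_nonneg_left (h2.trans (add_le_add_right h3 _)) ((hD i).1 v)
        linarith
    _ = Real.exp (s ^ 2) := by
        rw [Finset.sum_add_distrib, ← Finset.mul_sum, Finset.sum_sub_distrib, ← Finset.sum_mul,
          ← Finset.sum_mul, (hD i).2]
        simp only [mul_ite, mul_one, mul_zero]
        rw [← tail]
        ring

/-- The exponential supermartingale of the counts. -/
theorem listExp_exp_le_one (hD : IsDist D) (S : Strategy n k) (hS : ∀ h, (S h).ProbesOnce)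
    (i : Fin n) (j : ℕ) (s : ℝ) (t : ℕ) :
    listExp D t (fun l => Real.exp (s * ((hitCount (natHistory (S.history l)) i j : ℝ) -
      tail D i j * (obsCount (natHistory (S.history l)) i j : ℝ)) -
        s ^ 2 * (obsCount (natHistory (S.history l)) i j : ℝ))) ≤ 1 := by
  let ψ : Obs n k → ℝ := fun o =>
    Real.exp (s * ((hitInd i j o : ℝ) - tail D i j * (obsInd i j o : ℝ)) - s ^ 2 * (obsInd i j o : ℝ))
  have hψ : ∀ i' c, ∑ v, D i' v * ψ (i', c, min v c) ≤ 1 := fun i' c => by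
    by_cases h : i' = i ∧ j ≤ (c : ℕ)
    · rw [h.1]
      -- Because `j ≤ c`, the censored value reaches `j` exactly when the true value does: a counted
      -- observation is an unbiased sample of the tail.
      have e : ∀ v, ψ (i, c, min v c) = Real.exp (-s ^ 2) *
          Real.exp (s * ((if j ≤ (v : ℕ) then 1 else 0) - tail D i j)) := fun v => by
        rw [← Real.exp_add]
        simp only [ψ, obsInd, hitInd, h.2, Fin.coe_min, le_min_iff]
        congr 1
        by_cases hv : j ≤ (v : ℕ)
        · simp [hv]; ring
        · simp [hv]; ring
      simp only [e, mul_left_comm _ (Real.exp (-s ^ 2)), ← Finset.mul_sum]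
      calc _ ≤ Real.exp (-s ^ 2) * Real.exp (s ^ 2) :=
            mul_le_mul_of_nonneg_left (sum_mul_exp_le hD i j s) (Real.exp_pos _).le
        _ = 1 := by rw [← Real.exp_add]; simp
    · simp only [ψ, obsInd, hitInd, h, false_and, if_false]
      simp [(hD i').2]
  have hprod : ∀ τ : List (Obs n k), (τ.map ψ).prod =
      Real.exp (s * (((τ.map (hitInd i j)).sum : ℝ) - tail D i j * ((τ.map (obsInd i j)).sum : ℝ)) -
        s ^ 2 * ((τ.map (obsInd i j)).sum : ℝ)) := fun τ => by
    induction τ with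
    | nil => simp
    | cons o τ ih =>
      rw [List.map_cons, List.prod_cons, ih]
      simp only [ψ]
      rw [← Real.exp_add]
      congr 1
      simp
      ring
  simp only [hitCount_natHistory, obsCount_natHistory, ← hprod]
  induction t with
  | zero => simp [listExp, Strategy.history]
  | succ t ih =>
    -- The policy of the last period is fixed by the earlier feedback, so integrating out that
    -- period contributes a factor at most one.
    refine le_trans (listExp_mono hD t fun l _ => ?_) ih
    simp only [S.history_append, List.flatten_append, List.map_append, List.prod_append,
      List.flatten_singleton, pexp_const_mul]
    refine mul_le_of_le_one_right (List.prod_nonneg fun a ha => ?_)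
      (pexp_prod_trace_le_one hD (fun o => (Real.exp_pos _).le) hψ _ (hS _))
    obtain ⟨o, -, rfl⟩ := List.mem_map.1 ha
    exact (Real.exp_pos _).le

end
end Censored

namespace Censored

/-! ## Correctness of the estimates -/

/-- Counting the numbers below a bound that satisfy a downward closed condition. -/
theorem count_range_spec (P : ℕ → Prop) [DecidablePred P] (hP : ∀ m, P (m + 1) → P m) (M : ℕ) :
    let u := ((List.range M).map fun m => if P m then 1 else 0).sum
    u ≤ M ∧ (u < M → ¬P u) ∧ ∀ m, u = m + 1 → P m := by
  induction M with
  | zero => simp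
  | succ M ih =>
    simp only [List.range_succ, List.map_append, List.sum_append, List.map_singleton,
      List.sum_singleton] at ih ⊢
    obtain ⟨h1, h2, h3⟩ := ih
    by_cases hM : P M
    · have hall : ∀ m ≤ M, P m := fun m hm => Nat.decreasingInduction (motive := fun m _ => P m)
        (fun _ _ h => hP _ h) hM hm
      have hu : ((List.range M).map fun m => if P m then 1 else 0).sum = M := by
        by_contra h
        exact h2 (by omega) (hall _ h1)
      simp only [hM, if_true, hu]
      exact ⟨le_rfl, fun h => absurd h (lt_irrefl _), fun m hm => by
        obtain rfl : m = M := by omega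
        exact hM⟩
    · simp only [hM, if_false, add_zero]
      refine ⟨by omega, fun _ => ?_, h3⟩
      rcases h1.lt_or_eq with h | h
      · exact h2 h
      · rw [h]; exact hM

/-- The width of the confidence interval after `N` observations. -/
noncomputable def radius (ℓ N : ℕ) : ℝ := 12 * √ℓ / √(N + 1)

theorem radius_nonneg (ℓ N : ℕ) : 0 ≤ radius ℓ N := by unfold radius; positivity

theorem radius_anti (ℓ : ℕ) {N N' : ℕ} (h : N ≤ N') : radius ℓ N' ≤ radius ℓ N := by
  unfold radius
  gcongr

/-- The tested condition says that `m / M` exceeds `S / N` by at most `√(8 * ℓ / N)`, with division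
and root cleared. The first grid point that fails it lies above the true value, while the last one
that satisfies it exceeds the true value by at most twice the deviation; one grid step is added for
rounding. -/
theorem upperBound_spec {M ℓ N S : ℕ} {G : ℝ} (hℓ : 0 < ℓ) (hN : N ≤ M) (hG0 : 0 ≤ G)
    (hG1 : G ≤ 1) (hS : |(S : ℝ) - G * N| ≤ √(8 * ℓ * N)) :
    upperBound M ℓ N S ≤ M ∧ M * G ≤ upperBound M ℓ N S ∧
      upperBound M ℓ N S ≤ M * G + M * radius ℓ N := by
  -- Truncated subtraction makes the condition true for all `m` below the empirical estimate, hence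
  -- downward closed.
  have hspec := count_range_spec
    (fun m => (m * N - S * M) * (m * N - S * M) ≤ 8 * ℓ * (M * M) * N) (fun m hm => by
      have : m * N - S * M ≤ (m + 1) * N - S * M := by
        rw [add_mul]; omega
      exact (Nat.mul_le_mul this this).trans hm) M
  change (upperBound M ℓ N S ≤ M ∧ _ ∧ ∀ m, upperBound M ℓ N S = m + 1 → _) at hspec
  obtain ⟨h1, h2, h3⟩ := hspec
  have hroot : √(8 * ℓ * N) ^ 2 = 8 * ℓ * N := Real.sq_sqrt (by positivity)
  have hr0 := Real.sqrt_nonneg (8 * ℓ * N : ℝ)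
  obtain ⟨hS1, hS2⟩ := abs_le.1 hS
  have hM0 : (0 : ℝ) ≤ M := Nat.cast_nonneg _
  have hN0 : (0 : ℝ) ≤ N := Nat.cast_nonneg _
  have hℓ1 : (1 : ℝ) ≤ √ℓ := Real.one_le_sqrt.2 (by exact_mod_cast hℓ)
  refine ⟨h1, ?_, ?_⟩
  · rcases h1.lt_or_eq with h | h
    · have hp := h2 h
      change ¬((upperBound M ℓ N S * N - S * M) * (upperBound M ℓ N S * N - S * M) ≤ _) at hp
      generalize upperBound M ℓ N S = u at *
      rw [not_le] at hp
      have hpos : S * M < u * N := by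
        by_contra hc
        rw [Nat.sub_eq_zero_of_le (not_lt.1 hc)] at hp
        omega
      have hp' : (8 * ℓ * (M * M) * N : ℝ) < (u * N - S * M) * (u * N - S * M) := by
        have := (Nat.cast_lt (α := ℝ)).2 hp
        push_cast [Nat.cast_sub hpos.le] at this
        exact this
      have hd : (0 : ℝ) < u * N - S * M := by
        have := (Nat.cast_lt (α := ℝ)).2 hpos
        push_cast at this
        linarith
      have h4 : M * √(8 * ℓ * N) ≤ u * N - S * M := by
        refine abs_le_of_sq_le_sq' ?_ hd.le |>.2
        rw [mul_pow, hroot]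
        nlinarith
      have hNpos : (0 : ℝ) < N := by
        rcases Nat.eq_zero_or_pos N with rfl | h0
        · simp at hpos
        · exact_mod_cast h0
      have h5 : M * G * N ≤ u * N := by nlinarith
      exact le_of_mul_le_mul_right h5 hNpos
    · rw [h]
      exact mul_le_of_le_one_right hM0 hG1
  · rcases Nat.eq_zero_or_pos N with rfl | hNpos
    -- Without samples the radius exceeds one and the claim is trivial.
    · have : (1 : ℝ) ≤ radius ℓ 0 := by
        simp only [radius, Nat.cast_zero, zero_add, Real.sqrt_one, div_one]
        linarith
      have h6 : (upperBound M ℓ 0 S : ℝ) ≤ M := by exact_mod_cast h1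
      nlinarith
    · rcases Nat.eq_zero_or_pos (upperBound M ℓ N S) with h0 | h0
      · rw [h0]
        simpa using add_nonneg (mul_nonneg hM0 hG0) (mul_nonneg hM0 (radius_nonneg ℓ N))
      · obtain ⟨m, hm⟩ : ∃ m, upperBound M ℓ N S = m + 1 := ⟨_, (Nat.succ_pred_eq_of_pos h0).symm⟩
        have hp := h3 m hm
        rw [hm]
        have hp' : ((m : ℝ) * N - S * M) ≤ M * √(8 * ℓ * N) := by
          by_contra hc
          rw [not_le] at hc
          have hd : (0 : ℝ) ≤ M * √(8 * ℓ * N) := by positivity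
          have hle : S * M ≤ m * N := by
            have : (S * M : ℝ) ≤ m * N := by linarith
            exact_mod_cast this
          have hq : ((m * N - S * M) * (m * N - S * M) : ℝ) ≤ 8 * ℓ * (M * M) * N := by
            have := (Nat.cast_le (α := ℝ)).2 hp
            push_cast [Nat.cast_sub hle] at this
            exact this
          have := mul_self_lt_mul_self hd hc
          nlinarith
        have hNp : (0 : ℝ) < N := by exact_mod_cast hNpos
        have hN1 : (1 : ℝ) ≤ N := by exact_mod_cast hNpos
        have hNM : (N : ℝ) ≤ M := by exact_mod_cast hN
        have h5 : √(8 * ℓ * N : ℝ) ≤ 3 * √ℓ * √N := by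
          rw [mul_assoc, Real.sqrt_mul (by norm_num), Real.sqrt_mul (by positivity)]
          have : √(8 : ℝ) ≤ 3 := Real.sqrt_le_iff.2 ⟨by norm_num, by norm_num⟩
          nlinarith [mul_nonneg (Real.sqrt_nonneg (ℓ : ℝ)) (Real.sqrt_nonneg (N : ℝ))]
        have hsN : √(N : ℝ) * √N = N := Real.mul_self_sqrt hN0
        have hsN0 := Real.sqrt_pos.2 hNp
        -- Two deviations of `3 * √ℓ * √N` and a rounding error of at most `√ℓ * √N`, all relative
        -- to `M`, add up to the constant 7. Passing from `√N` to `√(N + 1)` costs `12 / 7`, whence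
        -- the 12 in `radius`.
        have hsN1 : √(N + 1 : ℝ) ≤ 12 / 7 * √N := by
          refine Real.sqrt_le_iff.2 ⟨by positivity, ?_⟩
          rw [mul_pow, Real.sq_sqrt hN0]
          linarith
        have h7 : 7 * √ℓ ≤ radius ℓ N * √N := by
          unfold radius
          rw [div_mul_eq_mul_div, le_div_iff₀ (by positivity)]
          nlinarith
        have hs1 : (1 : ℝ) ≤ √N := Real.one_le_sqrt.2 hN1
        have h8 : ((m + 1 : ℕ) : ℝ) * N ≤ (M * G + M * radius ℓ N) * N := by
          have e1 : (m : ℝ) * N ≤ M * (G * N) + 2 * (M * (3 * √ℓ * √N)) := by nlinarith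
          have e2 : (N : ℝ) ≤ M * (√ℓ * √N) := by
            have : (1 : ℝ) ≤ √ℓ * √N := by nlinarith
            nlinarith
          have e3 : 7 * √ℓ * √N ≤ radius ℓ N * N := by
            have := mul_le_mul_of_nonneg_right h7 hsN0.le
            rwa [mul_assoc (radius ℓ N), hsN] at this
          have e4 : M * (7 * √ℓ * √N) ≤ M * (radius ℓ N * N) := mul_le_mul_of_nonneg_left e3 hM0
          push_cast
          linarith
        exact le_of_mul_le_mul_right h8 hNp

/-- `x` is above `y` if `up`, and below `y` otherwise. -/
def OnSide (up : Bool) (x y : ℝ) : Prop := if up = true then y ≤ x else x ≤ y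

/-- The lower bound is the upper bound for the complementary event, with `N - S` successes and
probability `1 - G`, reflected in `M`. -/
theorem confBound_spec (up : Bool) {M ℓ N S : ℕ} {G : ℝ} (hℓ : 0 < ℓ) (hN : N ≤ M) (hG0 : 0 ≤ G)
    (hG1 : G ≤ 1) (hSN : S ≤ N) (hS : |(S : ℝ) - G * N| ≤ √(8 * ℓ * N)) :
    OnSide up (confBound up M ℓ N S) (M * G) ∧
      |(confBound up M ℓ N S : ℝ) - M * G| ≤ M * radius ℓ N := by
  have hr : 0 ≤ M * radius ℓ N := mul_nonneg (Nat.cast_nonneg _) (radius_nonneg _ _)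
  cases up
  · have hS' : |((N - S : ℕ) : ℝ) - (1 - G) * N| ≤ √(8 * ℓ * N) := by
      rw [Nat.cast_sub hSN, ← abs_neg]
      convert hS using 2
      ring
    obtain ⟨h1, h2, h3⟩ := upperBound_spec hℓ hN (by linarith) (by linarith) hS'
    simp only [OnSide, confBound, Bool.false_eq_true, if_false, Nat.cast_sub h1]
    exact ⟨by linarith, abs_le.2 ⟨by linarith, by linarith⟩⟩
  · obtain ⟨h1, h2, h3⟩ := upperBound_spec hℓ hN hG0 hG1 hS
    simp only [OnSide, confBound, if_true]
    exact ⟨h2, abs_le.2 ⟨by linarith, by linarith⟩⟩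

theorem tailWeight_zero (up : Bool) (M ℓ : ℕ) (h : List (List (ℕ × ℕ × ℕ))) (i : ℕ) :
    tailWeight up M ℓ h i 0 = M := rfl

theorem tailWeight_succ (up : Bool) (M ℓ : ℕ) (h : List (List (ℕ × ℕ × ℕ))) (i j : ℕ) :
    tailWeight up M ℓ h i (j + 1) = min (tailWeight up M ℓ h i j)
      (confBound up M ℓ (obsCount h i (j + 1)) (hitCount h i (j + 1))) := by
  simp [tailWeight, List.range_succ]

section
variable {n k : ℕ} {D : Fin n → Fin k → ℝ}

theorem tail_nonneg (hD : IsDist D) (i : Fin n) (j : ℕ) : 0 ≤ tail D i j :=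
  Finset.sum_nonneg fun v _ => by
    split_ifs
    exacts [(hD i).1 v, le_rfl]

theorem tail_anti (hD : IsDist D) (i : Fin n) {j j' : ℕ} (h : j ≤ j') :
    tail D i j' ≤ tail D i j := by
  refine Finset.sum_le_sum fun v _ => ?_
  split_ifs
  exacts [le_rfl, by omega, (hD i).1 v, le_rfl]

theorem tail_zero (hD : IsDist D) (i : Fin n) : tail D i 0 = 1 := by
  simpa [tail] using (hD i).2

theorem tail_le_one (hD : IsDist D) (i : Fin n) (j : ℕ) : tail D i j ≤ 1 :=
  tail_zero hD i ▸ tail_anti hD i (Nat.zero_le j)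

theorem tail_eq_zero (i : Fin n) {j : ℕ} (hj : k ≤ j) : tail D i j = 0 :=
  Finset.sum_eq_zero fun v _ => if_neg (by omega)

theorem obsCount_anti (h : List (List (ℕ × ℕ × ℕ))) (i : ℕ) {j j' : ℕ} (hj : j ≤ j') :
    obsCount h i j' ≤ obsCount h i j := by
  refine List.sum_le_sum fun o _ => ?_
  split_ifs
  exacts [le_rfl, by omega, Nat.zero_le _, le_rfl]

theorem hitCount_le_obsCount (h : List (List (ℕ × ℕ × ℕ))) (i j : ℕ) :
    hitCount h i j ≤ obsCount h i j := by
  refine List.sum_le_sum fun o _ => ?_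
  split_ifs
  exacts [le_rfl, by omega, Nat.zero_le _, le_rfl]

/-- All confidence intervals are correct. -/
def Accurate (D : Fin n → Fin k → ℝ) (ℓ : ℕ) (h : List (List (Obs n k))) : Prop :=
  ∀ (i : Fin n), ∀ r < k - 1, |(hitCount (natHistory h) i (r + 1) : ℝ) -
    tail D i (r + 1) * obsCount (natHistory h) i (r + 1)| ≤
      √(8 * ℓ * (obsCount (natHistory h) i (r + 1) : ℕ))

/-- The running minimum, needed for nonnegative point weights, spoils neither side nor accuracy:
true tails decrease in `j`, and radii increase since fewer probes reach higher thresholds. An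
earlier bound is thus never too low for the later tail. -/
theorem tailWeight_spec (hD : IsDist D) (up : Bool) {M ℓ : ℕ} (hℓ : 0 < ℓ)
    {h : List (List (Obs n k))} (hM : ∀ (i : Fin n) j, obsCount (natHistory h) i j ≤ M)
    (hh : Accurate D ℓ h) (i : Fin n) : ∀ j < k,
      OnSide up (tailWeight up M ℓ (natHistory h) i j) (M * tail D i j) ∧
      |(tailWeight up M ℓ (natHistory h) i j : ℝ) - M * tail D i j| ≤
        M * radius ℓ (obsCount (natHistory h) i j) := by
  have hM0 : (0 : ℝ) ≤ M := Nat.cast_nonneg _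
  intro j
  induction j with
  | zero =>
    intro _
    rw [tailWeight_zero, tail_zero hD, mul_one, sub_self, abs_zero]
    exact ⟨by cases up <;> simp [OnSide], mul_nonneg hM0 (radius_nonneg _ _)⟩
  | succ j ih =>
    intro hj
    obtain ⟨h1, h2⟩ := ih (by omega)
    obtain ⟨h3, h4⟩ := confBound_spec up hℓ (hM i (j + 1)) (tail_nonneg hD i (j + 1))
      (tail_le_one hD i (j + 1)) (hitCount_le_obsCount _ _ _) (hh i j (by omega))
    have h5 := mul_le_mul_of_nonneg_left (tail_anti hD i (Nat.le_succ j)) hM0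
    have h6 := mul_le_mul_of_nonneg_left
      (radius_anti ℓ (obsCount_anti (natHistory h) i (Nat.le_succ j))) hM0
    rw [Nat.succ_eq_add_one] at h5 h6
    rw [tailWeight_succ, Nat.cast_min]
    rw [abs_le] at h2 h4 ⊢
    cases up
    · simp only [OnSide, Bool.false_eq_true, if_false] at h1 h3 ⊢
      refine ⟨(min_le_right _ _).trans h3, ?_, ?_⟩
      · rw [neg_le_sub_iff_le_add, ← sub_le_iff_le_add]
        exact le_min (by linarith) (by linarith)
      · exact (sub_le_sub_right (min_le_right _ _) _).trans h4.2
    · simp only [OnSide, if_true] at h1 h3 ⊢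
      have h7 := le_min (h5.trans h1) h3
      have h8 := mul_nonneg hM0 (radius_nonneg ℓ (obsCount (natHistory h) i (j + 1)))
      exact ⟨h7, by linarith, (sub_le_sub_right (min_le_right _ _) _).trans h4.2⟩

/-- The weights telescope to the estimated tails. -/
theorem sum_pmfWeight (up : Bool) (M ℓ : ℕ) (h : List (List (ℕ × ℕ × ℕ))) (i m : ℕ) :
    ∑ v : Fin k, (if m ≤ (v : ℕ) then (pmfWeight up k M ℓ h i v : ℝ) else 0) =
      if m < k then (tailWeight up M ℓ h i m : ℝ) else 0 := by
  let W : ℕ → ℝ := fun j => if j < k then (tailWeight up M ℓ h i j : ℝ) else 0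
  have hw : ∀ v < k, (pmfWeight up k M ℓ h i v : ℝ) = W v - W (v + 1) := fun v hv => by
    simp only [pmfWeight, W, hv, if_true]
    by_cases h1 : v + 1 + 1 ≤ k
    · rw [if_pos h1, if_pos (by omega), Nat.cast_sub]
      rw [tailWeight_succ]
      exact min_le_left _ _
    · rw [if_neg h1, if_neg (by omega)]
      simp
  rw [Fin.sum_univ_eq_sum_range (fun v => if m ≤ v then (pmfWeight up k M ℓ h i v : ℝ) else 0) k,
    Finset.sum_congr rfl (g := fun v => if m ≤ v then W v - W (v + 1) else 0)
      fun v hv => by rw [hw v (Finset.mem_range.1 hv)], ← Finset.sum_filter]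
  by_cases hm : m < k
  · have e : (Finset.range k).filter (fun v => m ≤ v) = Finset.Ico m k := by
      ext v; simp only [Finset.mem_filter, Finset.mem_range, Finset.mem_Ico]; tauto
    rw [e, if_pos hm]
    have := Finset.sum_Ico_sub (fun v => -W v) hm.le
    simp only [neg_sub_neg] at this
    rw [this]
    simp [W, hm]
  · rw [if_neg hm]
    refine Finset.sum_eq_zero fun v hv => ?_
    rw [Finset.mem_filter, Finset.mem_range] at hv
    omega

theorem sum_pmfWeight_univ (hk : 0 < k) (up : Bool) (M ℓ : ℕ) (h : List (List (ℕ × ℕ × ℕ)))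
    (i : ℕ) : ∑ v : Fin k, pmfWeight up k M ℓ h i v = M := by
  have := sum_pmfWeight (k := k) up M ℓ h i 0
  simp only [Nat.zero_le, if_true, hk, tailWeight_zero] at this
  exact_mod_cast this

theorem isDist_ratDist {w : Fin n → Fin k → ℕ} (hw : ∀ i, 0 < ∑ j, w i j) :
    IsDist (ratDist w) := fun i => by
  refine ⟨fun j => by unfold ratDist; positivity, ?_⟩
  have : (0 : ℝ) < ∑ j, (w i j : ℝ) := by exact_mod_cast hw i
  simp only [ratDist]
  rw [← Finset.sum_div, div_self this.ne']

theorem tail_ratDist_pmfWeight (hk : 0 < k) (up : Bool) (M ℓ : ℕ) (h : List (List (ℕ × ℕ × ℕ)))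
    (i : Fin n) (m : ℕ) :
    tail (ratDist fun (i : Fin n) (j : Fin k) => pmfWeight up k M ℓ h i j) i m =
      (if m < k then (tailWeight up M ℓ h i m : ℝ) else 0) / M := by
  have h1 : ∑ v : Fin k, (pmfWeight up k M ℓ h i v : ℝ) = M := by
    exact_mod_cast sum_pmfWeight_univ hk up M ℓ h i
  rw [← sum_pmfWeight, Finset.sum_div]
  simp only [tail, ratDist, h1]
  refine Finset.sum_congr rfl fun v _ => ?_
  split_ifs <;> simp

/-- The tails of the estimated distributions are on the right side of the true ones, and close. -/
theorem tail_estimate (hD : IsDist D) (hk : 0 < k) (up : Bool) {M ℓ : ℕ} (hℓ : 0 < ℓ) (hM0 : 0 < M)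
    {h : List (List (Obs n k))} (hM : ∀ (i : Fin n) j, obsCount (natHistory h) i j ≤ M)
    (hh : Accurate D ℓ h) (i : Fin n) (j : ℕ) :
    OnSide up (tail (ratDist fun (i : Fin n) (j : Fin k) => pmfWeight up k M ℓ (natHistory h) i j) i j)
      (tail D i j) ∧
    |tail (ratDist fun (i : Fin n) (j : Fin k) => pmfWeight up k M ℓ (natHistory h) i j) i j -
      tail D i j| ≤ radius ℓ (obsCount (natHistory h) i j) := by
  rw [tail_ratDist_pmfWeight hk]
  have hM' : (0 : ℝ) < M := by exact_mod_cast hM0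
  by_cases hj : j < k
  · rw [if_pos hj]
    obtain ⟨h1, h2⟩ := tailWeight_spec hD up hℓ hM hh i j hj
    constructor
    · cases up
      · simp only [OnSide, Bool.false_eq_true, if_false] at h1 ⊢
        rwa [div_le_iff₀' hM']
      · simp only [OnSide, if_true] at h1 ⊢
        rwa [le_div_iff₀' hM']
    · have e : (tailWeight up M ℓ (natHistory h) i j : ℝ) / M - tail D i j =
          (tailWeight up M ℓ (natHistory h) i j - M * tail D i j) / M := by
        field_simp
      rw [e, abs_div, abs_of_pos hM']
      rwa [div_le_iff₀' hM']
  · rw [if_neg hj, tail_eq_zero i (not_lt.1 hj), zero_div, sub_self, abs_zero]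
    exact ⟨by cases up <;> simp [OnSide], radius_nonneg _ _⟩

end
end Censored

namespace Censored

/-! ## The regret -/

section
variable {n k : ℕ} {D E : Fin n → Fin k → ℝ}

theorem sum_obsInd_le_one (i : Fin n) (j : ℕ) {τ : List (Obs n k)} (hτ : (τ.map Prod.fst).Nodup) :
    (τ.map (obsInd i j)).sum ≤ 1 := by
  induction τ with
  | nil => simp
  | cons o τ ih =>
    simp only [List.map_cons, List.nodup_cons, List.sum_cons] at hτ ⊢
    by_cases h : o.1 = i
    · have h0 : (τ.map (obsInd i j)).sum = 0 := by
        refine List.sum_eq_zero fun a ha => ?_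
        obtain ⟨o', ho', rfl⟩ := List.mem_map.1 ha
        refine if_neg fun h' => hτ.1 ?_
        rw [h, ← h'.1]
        exact List.mem_map_of_mem ho'
      rw [h0, obsInd]
      split_ifs <;> simp
    · rw [obsInd, if_neg fun h' => h h'.1, zero_add]
      exact ih hτ.2

theorem Policy.ProbesOnce.sum_obsInd_le_one {σ : Policy n k} (hσ : σ.ProbesOnce) (i : Fin n) (j : ℕ)
    (x : Fin n → Fin k) : ((σ.trace x).map (obsInd i j)).sum ≤ 1 := by
  refine Censored.sum_obsInd_le_one i j ?_
  have := hσ x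
  rwa [Policy.trace, List.map_map]

theorem obsCount_append (h : List (List (Obs n k))) (τ : List (Obs n k)) (i : Fin n) (j : ℕ) :
    obsCount (natHistory (h ++ [τ])) i j =
      obsCount (natHistory h) i j + (τ.map (obsInd i j)).sum := by
  simp [obsCount_natHistory]

theorem Strategy.obsCount_history_le {S : Strategy n k} (hS : ∀ h, (S h).ProbesOnce)
    (l : List (Fin n → Fin k)) (i : Fin n) (j : ℕ) :
    obsCount (natHistory (S.history l)) i j ≤ l.length := by
  induction l using List.reverseRecOn with
  | nil => simp [Strategy.history, natHistory, obsCount]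
  | append_singleton l x ih =>
    rw [S.history_append, obsCount_append, List.length_append, List.length_singleton]
    exact Nat.add_le_add ih ((hS _).sum_obsInd_le_one i j x)

/-- An exponential certificate that a confidence interval is wrong. -/
theorem one_le_exp_add_exp {ℓ N : ℕ} {y : ℝ} (hN : 0 < N) (hy : √(8 * ℓ * N) < |y|) :
    1 ≤ Real.exp (-2 * ℓ) * Real.exp (√(2 * ℓ / N) * y - √(2 * ℓ / N) ^ 2 * N) ∨
      1 ≤ Real.exp (-2 * ℓ) * Real.exp (-√(2 * ℓ / N) * y - (-√(2 * ℓ / N)) ^ 2 * N) := by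
  have hN' : (0 : ℝ) < N := by exact_mod_cast hN
  -- The parameter is tuned so that the quadratic term is `2 * ℓ` and the linear one exceeds `4 *
  -- ℓ`, which leaves at least `2 * ℓ` to offset the prefactor.
  have h1 : √(2 * ℓ / N) ^ 2 * N = 2 * ℓ := by
    rw [Real.sq_sqrt (by positivity)]
    field_simp
  have h2 : √(2 * ℓ / N : ℝ) * √(8 * ℓ * N) = 4 * ℓ := by
    rw [← Real.sqrt_mul (by positivity)]
    have : (2 * ℓ / N * (8 * ℓ * N) : ℝ) = (4 * ℓ) ^ 2 := by
      field_simp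
      ring
    rw [this, Real.sqrt_sq (by positivity)]
  have h3 := mul_le_mul_of_nonneg_left hy.le (Real.sqrt_nonneg (2 * ℓ / N : ℝ))
  rw [neg_sq, h1]
  simp only [← Real.exp_add, Real.one_le_exp_iff]
  rcases abs_cases y with ⟨h, _⟩ | ⟨h, _⟩
  · left; rw [h] at h3; linarith
  · right; rw [h] at h3; linarith

open Classical in
/-- It is unlikely that some confidence interval is wrong. -/
theorem listExp_not_accurate_le (hD : IsDist D) {S : Strategy n k} (hS : ∀ h, (S h).ProbesOnce)
    (ℓ : ℕ) {t T : ℕ} (ht : t ≤ T) :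
    listExp D t (fun l => if Accurate D ℓ (S.history l) then 0 else 1) ≤
      n * (k - 1 : ℕ) * (T * (2 * Real.exp (-2 * ℓ))) := by
  let Z : Fin n → ℕ → ℝ → List (Fin n → Fin k) → ℝ := fun i r s l =>
    Real.exp (s * ((hitCount (natHistory (S.history l)) i (r + 1) : ℝ) -
      tail D i (r + 1) * (obsCount (natHistory (S.history l)) i (r + 1) : ℝ)) -
        s ^ 2 * (obsCount (natHistory (S.history l)) i (r + 1) : ℝ))
  let c : ℝ := Real.exp (-2 * ℓ)
  -- The right parameter depends on the random sample count, so the union bound runs over all its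
  -- possible positive values `m + 1 ≤ T`.
  let s : ℕ → ℝ := fun m => √(2 * ℓ / (m + 1 : ℕ))
  have hc : 0 ≤ c := (Real.exp_pos _).le
  have hZ : ∀ i r s l, 0 ≤ Z i r s l := fun _ _ _ _ => (Real.exp_pos _).le
  have hpos : ∀ i r m l, 0 ≤ c * Z i r (s m) l + c * Z i r (-s m) l := fun i r m l =>
    add_nonneg (mul_nonneg hc (hZ _ _ _ _)) (mul_nonneg hc (hZ _ _ _ _))
  calc _ ≤ listExp D t (fun l => ∑ i, ∑ r ∈ Finset.range (k - 1), ∑ m ∈ Finset.range T,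
        (c * Z i r (s m) l + c * Z i r (-s m) l)) := by
        refine listExp_mono hD t fun l hl => ?_
        split_ifs with h
        · exact Finset.sum_nonneg fun i _ => Finset.sum_nonneg fun r _ =>
            Finset.sum_nonneg fun m _ => hpos i r m l
        · simp only [Accurate, not_forall, not_le] at h
          obtain ⟨i, r, hr, h⟩ := h
          -- With no samples both counts vanish and the interval cannot be wrong.
          have hN : 0 < obsCount (natHistory (S.history l)) i (r + 1) := by
            refine Nat.pos_of_ne_zero fun h0 => ?_
            have h1 := hitCount_le_obsCount (natHistory (S.history l)) i (r + 1)
            rw [h0] at h h1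
            rw [Nat.le_zero.1 h1] at h
            simp at h
          have hNT : obsCount (natHistory (S.history l)) i (r + 1) ≤ T :=
            (Strategy.obsCount_history_le hS l i (r + 1)).trans (hl ▸ ht)
          obtain ⟨m, hm⟩ := Nat.exists_eq_succ_of_ne_zero hN.ne'
          have key : 1 ≤ c * Z i r (s m) l + c * Z i r (-s m) l := by
            have h1 := one_le_exp_add_exp hN h
            have e1 : √(2 * ℓ / (obsCount (natHistory (S.history l)) i (r + 1) : ℝ)) = s m := by
              rw [hm]
            rw [e1] at h1
            rcases h1 with h1 | h1
            · exact h1.trans (le_add_of_nonneg_right (mul_nonneg hc (hZ _ _ _ _)))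
            · exact h1.trans (le_add_of_nonneg_left (mul_nonneg hc (hZ _ _ _ _)))
          refine key.trans ?_
          refine le_trans ?_ (Finset.single_le_sum (fun i _ => Finset.sum_nonneg fun r _ =>
            Finset.sum_nonneg fun m _ => hpos i r m l) (Finset.mem_univ i))
          refine le_trans ?_ (Finset.single_le_sum (fun r _ =>
            Finset.sum_nonneg fun m _ => hpos i r m l) (Finset.mem_range.2 hr))
          exact Finset.single_le_sum (f := fun m => c * Z i r (s m) l + c * Z i r (-s m) l)
            (fun m _ => hpos i r m l) (Finset.mem_range.2 (by omega))
    _ ≤ ∑ i : Fin n, ∑ r ∈ Finset.range (k - 1), ∑ m ∈ Finset.range T, 2 * c := by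
        simp only [listExp_sum, listExp_add, listExp_const_mul]
        refine Finset.sum_le_sum fun i _ => Finset.sum_le_sum fun r _ =>
          Finset.sum_le_sum fun m _ => ?_
        rw [two_mul]
        exact add_le_add
          (mul_le_of_le_one_right hc (listExp_exp_le_one hD S hS i (r + 1) (s m) t))
          (mul_le_of_le_one_right hc (listExp_exp_le_one hD S hS i (r + 1) (-s m) t))
    _ = _ := by
        simp only [Finset.sum_const, Finset.card_univ, Fintype.card_fin, Finset.card_range,
          nsmul_eq_mul, c]
        ring

/-- This is `1 / √(N + 1) ≤ 2 * (√(N + 1) - √N)`: the width charged for a new sample is at most the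
growth of a potential proportional to `√N`. -/
theorem radius_mul_le (ℓ N : ℕ) {m : ℕ} (hm : m ≤ 1) :
    radius ℓ N * m ≤ 24 * √ℓ * √((N + m : ℕ) : ℝ) - 24 * √ℓ * √(N : ℝ) := by
  interval_cases m
  · simp
  · have hb := Real.sqrt_nonneg (N : ℝ)
    have hb2 : √(N : ℝ) ^ 2 = N := Real.sq_sqrt (Nat.cast_nonneg _)
    have ha : 0 < √(N + 1 : ℝ) := Real.sqrt_pos.2 (by positivity)
    have ha2 : √(N + 1 : ℝ) ^ 2 = N + 1 := Real.sq_sqrt (by positivity)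
    unfold radius
    push_cast
    rw [mul_one, div_le_iff₀ ha]
    have h1 : 1 ≤ 2 * (√(N + 1 : ℝ) - √(N : ℝ)) * √(N + 1 : ℝ) := by nlinarith
    have := mul_le_mul_of_nonneg_left h1 (Real.sqrt_nonneg (ℓ : ℝ))
    linarith

open Classical in
/-- Summation of the losses over the periods. -/
theorem sum_listExp_le (hD : IsDist D) {S : Strategy n k} (hS : ∀ h, (S h).ProbesOnce) (ℓ T : ℕ)
    {B : ℝ} (hB : 0 ≤ B) (loss : List (List (Obs n k)) → ℝ)
    (hloss : ∀ l : List (Fin n → Fin k), l.length < T → loss (S.history l) ≤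
      B * ((if Accurate D ℓ (S.history l) then 0 else 1) +
        ∑ i : Fin n, ∑ r ∈ Finset.range (k - 1),
          radius ℓ (obsCount (natHistory (S.history l)) i (r + 1)) *
          pexp D fun x => (((S (S.history l)).trace x).map (obsInd i (r + 1))).sum)) :
    ∑ t ∈ Finset.range T, listExp D t (fun l => loss (S.history l)) ≤
      B * (T * (n * (k - 1 : ℕ) * (T * (2 * Real.exp (-2 * ℓ)))) +
        n * (k - 1 : ℕ) * (24 * √ℓ * √T)) := by
  -- The potential of a pair of item and index. Up to failure of the intervals, the expected loss of
  -- a period is at most `B` times the expected total increase of the potentials.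
  let Φ : Fin n → ℕ → List (Fin n → Fin k) → ℝ := fun i r l =>
    24 * √ℓ * √(obsCount (natHistory (S.history l)) i (r + 1) : ℝ)
  have hstep : ∀ t < T, listExp D t (fun l => loss (S.history l)) ≤
      B * (n * (k - 1 : ℕ) * (T * (2 * Real.exp (-2 * ℓ)))) +
        ∑ i, ∑ r ∈ Finset.range (k - 1),
          B * (listExp D (t + 1) (Φ i r) - listExp D t (Φ i r)) := fun t ht => by
    calc _ ≤ listExp D t (fun l => B * (if Accurate D ℓ (S.history l) then 0 else 1) +
          ∑ i, ∑ r ∈ Finset.range (k - 1), (B * pexp D (fun x => Φ i r (l ++ [x])) +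
            (-B) * Φ i r l)) := by
          refine listExp_mono hD t fun l hl => (hloss l (hl ▸ ht)).trans ?_
          rw [mul_add, Finset.mul_sum]
          refine add_le_add le_rfl (Finset.sum_le_sum fun i _ => ?_)
          rw [Finset.mul_sum]
          refine Finset.sum_le_sum fun r _ => ?_
          rw [neg_mul, ← sub_eq_add_neg, ← mul_sub]
          refine mul_le_mul_of_nonneg_left ?_ hB
          rw [← pexp_const_mul, le_sub_iff_add_le, ← pexp_const hD (Φ i r l), ← pexp_add]
          refine pexp_mono hD fun x => ?_
          rw [← le_sub_iff_add_le]
          simp only [Φ, S.history_append, obsCount_append]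
          exact radius_mul_le _ _ ((hS _).sum_obsInd_le_one i (r + 1) x)
      _ ≤ _ := by
          simp only [listExp_add, listExp_const_mul, listExp_sum]
          refine add_le_add (mul_le_mul_of_nonneg_left
            (listExp_not_accurate_le hD hS ℓ ht.le) hB) (le_of_eq ?_)
          refine Finset.sum_congr rfl fun i _ => Finset.sum_congr rfl fun r _ => ?_
          rw [neg_mul, ← sub_eq_add_neg, ← mul_sub]
          rfl
  refine (Finset.sum_le_sum fun t ht => hstep t (Finset.mem_range.1 ht)).trans ?_
  rw [Finset.sum_add_distrib, Finset.sum_const, Finset.card_range, nsmul_eq_mul, mul_add]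
  refine add_le_add (le_of_eq (by ring)) ?_
  rw [Finset.sum_comm]
  have h1 : ∀ i : Fin n, ∑ t ∈ Finset.range T, ∑ r ∈ Finset.range (k - 1),
      B * (listExp D (t + 1) (Φ i r) - listExp D t (Φ i r)) ≤
        (k - 1 : ℕ) * (B * (24 * √ℓ * √T)) := fun i => by
    rw [Finset.sum_comm]
    have h2 : ∀ r ∈ Finset.range (k - 1), ∑ t ∈ Finset.range T,
        B * (listExp D (t + 1) (Φ i r) - listExp D t (Φ i r)) ≤ B * (24 * √ℓ * √T) := fun r _ => by
      rw [← Finset.mul_sum, Finset.sum_range_sub fun t => listExp D t (Φ i r)]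
      refine mul_le_mul_of_nonneg_left ?_ hB
      have h3 : 0 ≤ listExp D 0 (Φ i r) := by simp only [listExp, Φ]; positivity
      have h4 : listExp D T (Φ i r) ≤ 24 * √ℓ * √T := by
        rw [← listExp_const hD T (24 * √ℓ * √T)]
        refine listExp_mono hD T fun l hl => mul_le_mul_of_nonneg_left (Real.sqrt_le_sqrt ?_)
          (by positivity)
        exact_mod_cast hl ▸ Strategy.obsCount_history_le hS l i (r + 1)
      linarith
    refine (Finset.sum_le_sum h2).trans (le_of_eq ?_)
    rw [Finset.sum_const, Finset.card_range, nsmul_eq_mul]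
  refine (Finset.sum_le_sum fun i _ => h1 i).trans (le_of_eq ?_)
  rw [Finset.sum_const, Finset.card_univ, Fintype.card_fin, nsmul_eq_mul]
  ring

end

/-! ### Values and optima -/

namespace Instance
variable {I : Instance} {D E : Fin I.n → Fin I.k → ℝ} {σ : Policy I.n I.k}

theorem f_nonneg (hσ : σ ∈ I.feasible) (x : Fin I.n → Fin I.k) : 0 ≤ I.f σ x :=
  I.value_nonneg σ hσ x

theorem f_le_fMax (hσ : σ ∈ I.feasible) (x : Fin I.n → Fin I.k) : I.f σ x ≤ I.fMax := by
  refine le_csSup ?_ ⟨σ, hσ, x, rfl⟩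
  -- Executions have at most `n` probes, so even over possibly infinitely many policies only
  -- finitely many values occur and the supremum is genuine.
  refine (((List.finite_length_le (Obs I.n I.k) I.n).image I.value).subset ?_).bddAbove
  rintro _ ⟨σ, hσ, x, rfl⟩
  refine ⟨σ.realized x, ?_, rfl⟩
  have := Policy.length_trace_le (I.probesOnce σ hσ) x
  simpa [Policy.trace, Policy.realized] using this

theorem fMax_nonneg (I : Instance) : 0 ≤ I.fMax := by
  obtain ⟨σ, hσ⟩ := I.feasible_nonempty
  exact (f_nonneg hσ fun _ => ⟨0, I.k_pos⟩).trans (f_le_fMax hσ _)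

theorem expected_nonneg (hD : IsDist D) (hσ : σ ∈ I.feasible) : 0 ≤ I.expected D σ := by
  rw [← pexp_const hD 0]
  exact pexp_mono hD fun x => f_nonneg hσ x

theorem expected_le_fMax (hD : IsDist D) (hσ : σ ∈ I.feasible) : I.expected D σ ≤ I.fMax := by
  rw [← pexp_const hD I.fMax]
  exact pexp_mono hD fun x => f_le_fMax hσ x

theorem opt_nonneg (hD : IsDist D) (g : Goal) : 0 ≤ I.opt D g := by
  cases g
  · exact Real.sInf_nonneg fun _ ⟨_, hσ, h⟩ => h ▸ expected_nonneg hD hσ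
  · exact Real.sSup_nonneg fun _ ⟨_, hσ, h⟩ => h ▸ expected_nonneg hD hσ

theorem opt_maximize_le (hD : IsDist D) : I.opt D .maximize ≤ I.fMax :=
  csSup_le (I.feasible_nonempty.image _) fun _ ⟨_, hσ, h⟩ => h ▸ expected_le_fMax hD hσ

/-- Under two distributions with close tails the expected values of a policy are close. -/
theorem abs_expected_sub_le (hI : I.LeafConstant) (hD : IsDist D) (hE : IsDist E)
    (hσ : σ ∈ I.feasible) {ρ : Fin I.n → ℕ → ℝ}
    (hρ : ∀ i j, |tail E i j - tail D i j| ≤ ρ i j) :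
    |I.expected E σ - I.expected D σ| ≤ I.fMax * ∑ i, ∑ r ∈ Finset.range (I.k - 1),
      ρ i (r + 1) * pexp D fun x => ((σ.trace x).map (obsInd i (r + 1))).sum := by
  classical
  -- Leaf constancy makes the objective a function of the censored trace; unreachable traces get the
  -- value 0.
  let g : List (Obs I.n I.k) → ℝ := fun τ => if h : ∃ x, σ.trace x = τ then I.f σ h.choose else 0
  have hg : ∀ x, g (σ.trace x) = I.f σ x := fun x => by
    have h : ∃ y, σ.trace y = σ.trace x := ⟨x, rfl⟩
    simp only [g, dif_pos h]
    exact hI σ hσ _ _ h.choose_spec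
  have h0 : ∀ τ, 0 ≤ g τ := fun τ => by
    simp only [g]
    split_ifs
    exacts [f_nonneg hσ _, le_rfl]
  have h1 : ∀ τ, g τ ≤ I.fMax := fun τ => by
    simp only [g]
    split_ifs
    exacts [f_le_fMax hσ _, I.fMax_nonneg]
  have h2 := abs_pexp_sub_pexp_le hD hE (abs_sum_sub_mul_min_le hD hE) σ (I.probesOnce σ hσ) g h0 h1
  simp only [hg] at h2
  refine h2.trans (mul_le_mul_of_nonneg_left ?_ I.fMax_nonneg)
  have hρ0 : ∀ i j, 0 ≤ ρ i j := fun i j => (abs_nonneg _).trans (hρ i j)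
  -- Regrouping by tail: a probe with threshold `c` is charged at the indices `r + 1 ≤ c`, exactly
  -- those at which it increments the sample count.
  have h3 : ∀ τ : List (Obs I.n I.k),
      (τ.map fun o => ∑ r ∈ Finset.range o.2.1, |tail E o.1 (r + 1) - tail D o.1 (r + 1)|).sum ≤
        ∑ i, ∑ r ∈ Finset.range (I.k - 1), ρ i (r + 1) * ((τ.map (obsInd i (r + 1))).sum : ℕ) := by
    intro τ
    induction τ with
    | nil => simp
    | cons o τ ih =>
      simp only [List.map_cons, List.sum_cons, Nat.cast_add, mul_add, Finset.sum_add_distrib]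
      refine add_le_add ?_ ih
      refine le_trans ?_ (Finset.single_le_sum (fun i _ => Finset.sum_nonneg fun r _ =>
        mul_nonneg (hρ0 i (r + 1)) (Nat.cast_nonneg _)) (Finset.mem_univ o.1))
      have hsub : Finset.range (o.2.1 : ℕ) ⊆ Finset.range (I.k - 1) := by
        have := o.2.1.2
        exact Finset.range_subset_range.2 (by omega)
      refine le_trans (Finset.sum_le_sum fun r hr => ?_) (Finset.sum_le_sum_of_subset_of_nonneg hsub
        fun r _ _ => mul_nonneg (hρ0 o.1 (r + 1)) (Nat.cast_nonneg _))
      rw [obsInd, if_pos ⟨rfl, Nat.succ_le_of_lt (Finset.mem_range.1 hr)⟩, Nat.cast_one, mul_one]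
      exact hρ _ _
  refine (pexp_mono hD fun x => h3 _).trans (le_of_eq ?_)
  simp only [pexp, Finset.mul_sum]
  rw [Finset.sum_comm]
  refine Finset.sum_congr rfl fun i _ => ?_
  rw [Finset.sum_comm]
  exact Finset.sum_congr rfl fun r _ => Finset.sum_congr rfl fun x _ => by ring

/-- The support is increasing, so a real level cuts it at some index; a level above the whole
support corresponds to index `k`. -/
theorem dominates_of_tail_le (I : Instance) {D E : Fin I.n → Fin I.k → ℝ}
    (h : ∀ i m, tail D i m ≤ tail E i m) : I.Dominates E D := by
  intro i r
  obtain ⟨m, hm⟩ : ∃ m : ℕ, ∀ j : Fin I.k, r ≤ I.a j ↔ m ≤ (j : ℕ) := by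
    by_cases hr : ∃ m : ℕ, ∃ hm : m < I.k, r ≤ I.a ⟨m, hm⟩
    · classical
      refine ⟨Nat.find hr, fun j => ⟨fun hj => Nat.find_min' hr ⟨j.2, hj⟩, fun hj => ?_⟩⟩
      obtain ⟨h1, h2⟩ := Nat.find_spec hr
      exact h2.trans (I.a_strictMono.monotone hj)
    · exact ⟨I.k, fun j => ⟨fun hj => absurd ⟨j, j.2, hj⟩ hr, fun hj => absurd j.2 (not_lt.2 hj)⟩⟩
  have := h i m
  simp only [tail, ← hm] at this
  simpa only [Finset.sum_filter] using this

end Instance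

end Censored

/-! ### The numerical bound, optimism, and the loss of one period -/

namespace Censored

/-- The numerical form of the regret bound. -/
theorem regret_sum_le (n k T : ℕ) :
    (T * (n * (k - 1 : ℕ) * (T * (2 * Real.exp (-2 * ((k * n * T).bits.length : ℕ))))) +
        n * (k - 1 : ℕ) * (24 * √((k * n * T).bits.length : ℕ) * √T) : ℝ) ≤
      50 * (n * k * √(k * T * Real.log (k * n * T))) := by
  rcases Nat.eq_zero_or_pos n with rfl | hn
  · simp
  rcases Nat.eq_zero_or_pos T with rfl | hT
  · simp
  -- With a single support value there is nothing to estimate and the left side vanishes. Otherwise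
  -- `k * n * T ≥ 2`, so the logarithm is bounded away from zero.
  rcases Nat.lt_or_ge k 2 with hk | hk
  · have : k - 1 = 0 := by omega
    rw [this]
    simp
    positivity
  have hm : 2 ≤ k * n * T := hk.trans ((Nat.le_mul_of_pos_right k hn).trans
    (Nat.le_mul_of_pos_right _ hT))
  have hmL : Real.log (k * n * T) = Real.log ((k * n * T : ℕ) : ℝ) := by push_cast; rfl
  rw [hmL, Nat.size_eq_bits_len]
  set m := k * n * T with hmdef
  set ℓ := Nat.size m with hℓdef
  set L := Real.log (m : ℝ) with hL
  have hm' : (2 : ℝ) ≤ m := by exact_mod_cast hm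
  have hm0 : (0 : ℝ) < m := by linarith
  have hlog2 := Real.log_two_gt_d9
  have hL2 : Real.log 2 ≤ L := Real.log_le_log (by norm_num) hm'
  -- From `2 ^ (ℓ - 1) ≤ m` and `log 2 ≤ L` one gets `ℓ ≤ 2 * L / log 2`, and `2 / log 2 < 3`.
  have hℓL : (ℓ : ℝ) ≤ 3 * L := by
    have hpos : 0 < ℓ := Nat.size_pos.2 (by omega)
    have h1 : 2 ^ (ℓ - 1) ≤ m := Nat.lt_size.1 (by omega)
    have h2 : ((ℓ - 1 : ℕ) : ℝ) * Real.log 2 ≤ L := by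
      rw [← Real.log_pow]
      exact Real.log_le_log (by positivity) (by exact_mod_cast h1)
    rw [Nat.cast_sub hpos, Nat.cast_one] at h2
    nlinarith
  -- Since `m < 2 ^ ℓ ≤ exp ℓ`, the failure probability beats the union bound and the sum over the
  -- periods; failures cost a constant.
  have hexp : Real.exp (-2 * ℓ) * (m * m) ≤ 1 := by
    have h1 : (m : ℝ) ≤ Real.exp ℓ := by
      have h2 : (m : ℝ) < 2 ^ ℓ := by exact_mod_cast Nat.lt_size_self m
      have h3 : (2 : ℝ) ^ ℓ ≤ Real.exp 1 ^ ℓ :=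
        pow_le_pow_left₀ (by norm_num) (by linarith [Real.add_one_le_exp 1]) ℓ
      rw [← Real.exp_nat_mul, mul_one] at h3
      linarith
    have h4 : Real.exp (-2 * ℓ) * (Real.exp ℓ * Real.exp ℓ) = 1 := by
      rw [← Real.exp_add, ← Real.exp_add, Real.exp_eq_one_iff]
      ring
    rw [← h4]
    gcongr
  have hk1 : ((k - 1 : ℕ) : ℝ) ≤ k := by exact_mod_cast Nat.sub_le k 1
  have hkr : (2 : ℝ) ≤ k := by exact_mod_cast hk
  have hnr : (1 : ℝ) ≤ n := by exact_mod_cast hn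
  have hTr : (1 : ℝ) ≤ T := by exact_mod_cast hT
  have hmr : (m : ℝ) = k * n * T := by rw [hmdef]; push_cast; rfl
  have hL0 : 0 < L := by linarith
  have hone : 1 ≤ √(k * T * L) := by
    refine Real.one_le_sqrt.2 ?_
    have : (2 : ℝ) ≤ k * T := by nlinarith
    nlinarith
  have hfirst : (T * (n * (k - 1 : ℕ) * (T * (2 * Real.exp (-2 * ℓ)))) : ℝ) ≤ 2 := by
    calc (T * (n * (k - 1 : ℕ) * (T * (2 * Real.exp (-2 * ℓ)))) : ℝ)
        ≤ T * (n * k * (T * (2 * Real.exp (-2 * ℓ)))) := by gcongr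
      _ = 2 * (Real.exp (-2 * ℓ) * (k * n * (T * T))) := by ring
      _ ≤ 2 * (Real.exp (-2 * ℓ) * (m * m)) := by
          have : (k * n * (T * T) : ℝ) ≤ m * m := by
            rw [hmr]
            have h1 : (1 : ℝ) ≤ k * n := by nlinarith
            have h2 : (0 : ℝ) ≤ k * n * (T * T) := by positivity
            nlinarith
          gcongr
      _ ≤ 2 := by linarith
  have hsecond : √(ℓ : ℝ) * √(T : ℝ) ≤ 2 * √(k * T * L) := by
    rw [← Real.sqrt_mul (Nat.cast_nonneg _)]
    refine Real.sqrt_le_iff.2 ⟨by positivity, ?_⟩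
    rw [mul_pow, Real.sq_sqrt (by positivity)]
    have h1 : (ℓ : ℝ) * T ≤ 3 * L * T := by gcongr
    have h2 : 2 * (T * L) ≤ k * (T * L) := by gcongr
    nlinarith [mul_pos (lt_of_lt_of_le one_pos hTr) hL0]
  have hnk : (1 : ℝ) ≤ n * k := by nlinarith
  have h3 : (n * (k - 1 : ℕ) * (24 * √ℓ * √T) : ℝ) ≤ n * k * (48 * √(k * T * L)) := by
    have : 24 * √(ℓ : ℝ) * √(T : ℝ) ≤ 48 * √(k * T * L) := by linarith
    gcongr
  have h4 : (2 : ℝ) ≤ n * k * (2 * √(k * T * L)) := by nlinarith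
  linarith

/-- The optimum under `E` is at least as good as the one under `D`. -/
def Instance.Optimistic (I : Instance) (E D : Fin I.n → Fin I.k → ℝ) : Goal → Prop
  | .minimize => I.opt E .minimize ≤ I.opt D .minimize
  | .maximize => I.opt D .maximize ≤ I.opt E .maximize

/-- For each monotone problem one side of the confidence intervals makes the estimated optimum at
least as good as the true one. -/
theorem Problem.exists_side {P : Problem} (hP : P.UpMonotone ∨ P.DownMonotone) :
    ∃ up : Bool, ∀ I ∈ P.instances, ∀ D E : Fin I.n → Fin I.k → ℝ, IsDist D → IsDist E →
      (∀ i m, OnSide up (tail E i m) (tail D i m)) → I.Optimistic E D P.goal := by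
  obtain ⟨goal, instances⟩ := P
  rcases hP with hP | hP <;> cases goal
  · exact ⟨true, fun I hI D E hD hE h =>
      hP I hI D E hD hE (I.dominates_of_tail_le fun i m => by simpa [OnSide] using h i m)⟩
  · exact ⟨false, fun I hI D E hD hE h =>
      hP I hI E D hE hD (I.dominates_of_tail_le fun i m => by simpa [OnSide] using h i m)⟩
  · exact ⟨false, fun I hI D E hD hE h =>
      hP I hI E D hE hD (I.dominates_of_tail_le fun i m => by simpa [OnSide] using h i m)⟩
  · exact ⟨true, fun I hI D E hD hE h =>
      hP I hI D E hD hE (I.dominates_of_tail_le fun i m => by simpa [OnSide] using h i m)⟩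

namespace Instance
variable {I : Instance}

theorem estimate_sum_pos (I : Instance) (up : Bool) (T : ℕ) (h : List (List (Obs I.n I.k)))
    (i : Fin I.n) : 0 < ∑ j, I.estimate up T h i j := by
  have := sum_pmfWeight_univ I.k_pos up (T + 1) (I.k * I.n * T).bits.length (natHistory h) i
  simp only [estimate, learnWeights, this]
  omega

/-- The expected loss of one period. -/
noncomputable def loss (I : Instance) (D : Fin I.n → Fin I.k → ℝ) (α : ℝ) (σ : Policy I.n I.k) :
    Goal → ℝ
  | .minimize => I.expected D σ - α * I.opt D .minimize
  | .maximize => α * I.opt D .maximize - I.expected D σ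

theorem regret_eq {D : Fin I.n → Fin I.k → ℝ} (hD : IsDist D) (T : ℕ) (S : Strategy I.n I.k)
    (α : ℝ) (g : Goal) : I.regret D T S α g =
      ∑ t ∈ Finset.range T, listExp D t fun l => I.loss D α (S (S.history l)) g := by
  cases g
  · simp only [regret, loss, expectedTotal_eq I hD, sub_eq_add_neg, listExp_add, listExp_const hD,
      Finset.sum_add_distrib, Finset.sum_const, Finset.card_range, nsmul_eq_mul]
    ring
  · have e : ∀ t, listExp D t (fun l => -I.expected D (S (S.history l))) =
        -listExp D t fun l => I.expected D (S (S.history l)) := fun t => by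
      have := listExp_const_mul (D := D) t (-1) fun l => I.expected D (S (S.history l))
      simpa only [neg_one_mul] using this
    simp only [regret, loss, expectedTotal_eq I hD, sub_eq_add_neg, listExp_add, listExp_const hD,
      Finset.sum_add_distrib, Finset.sum_const, Finset.card_range, nsmul_eq_mul, e,
      Finset.sum_neg_distrib]
    ring

/-- Playing an approximate policy for an optimistic distribution `E` loses no more than the error
made by estimating its value under `E`. -/
theorem loss_le {D E : Fin I.n → Fin I.k → ℝ} (hD : IsDist D) {α : ℝ} {g : Goal}
    (hα : g.IsRatio α) {σ : Policy I.n I.k} (hσ : σ ∈ I.feasible)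
    (happ : I.IsApprox E α σ g) (hopt : I.Optimistic E D g) :
    I.loss D α σ g ≤ |I.expected E σ - I.expected D σ| := by
  cases g
  · replace hα : 1 ≤ α := hα
    replace hopt : I.opt E .minimize ≤ I.opt D .minimize := hopt
    replace happ : I.expected E σ ≤ α * I.opt E .minimize := happ
    simp only [loss]
    have := mul_le_mul_of_nonneg_left hopt (by linarith : (0 : ℝ) ≤ α)
    linarith [neg_abs_le (I.expected E σ - I.expected D σ)]
  · replace hopt : I.opt D .maximize ≤ I.opt E .maximize := hopt
    replace happ : α * I.opt E .maximize ≤ I.expected E σ := happ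
    simp only [loss]
    rcases le_total 0 α with h | h
    · have := mul_le_mul_of_nonneg_left hopt h
      linarith [le_abs_self (I.expected E σ - I.expected D σ)]
    -- For maximization a negative ratio is admitted; then the benchmark is at most zero and so is
    -- the loss.
    · have h1 := mul_nonpos_of_nonpos_of_nonneg h (opt_nonneg hD .maximize)
      linarith [expected_nonneg hD hσ, abs_nonneg (I.expected E σ - I.expected D σ)]

/-- The trivial bound, for periods in which some confidence interval is wrong. -/
theorem loss_le_fMax {D : Fin I.n → Fin I.k → ℝ} (hD : IsDist D) {α : ℝ} {g : Goal}
    (hα : g.IsRatio α) {σ : Policy I.n I.k} (hσ : σ ∈ I.feasible) :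
    I.loss D α σ g ≤ I.fMax := by
  have h0 := expected_nonneg hD hσ
  have h1 := expected_le_fMax hD hσ
  cases g
  · replace hα : 1 ≤ α := hα
    simp only [loss]
    have := mul_nonneg (by linarith : (0 : ℝ) ≤ α) (opt_nonneg hD .minimize)
    linarith
  · replace hα : α ≤ 1 := hα
    simp only [loss]
    have h2 := opt_nonneg hD .maximize
    have h3 : α * I.opt D .maximize ≤ I.opt D .maximize := mul_le_of_le_one_left h2 hα
    linarith [opt_maximize_le hD]

theorem tail_ratDist_estimate {D : Fin I.n → Fin I.k → ℝ} (hD : IsDist D) (up : Bool) {T : ℕ}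
    {h : List (List (Obs I.n I.k))} (hT : 0 < T)
    (hM : ∀ (i : Fin I.n) j, obsCount (natHistory h) i j ≤ T + 1)
    (hh : Accurate D (I.k * I.n * T).bits.length h) (i : Fin I.n) (j : ℕ) :
    OnSide up (tail (ratDist (I.estimate up T h)) i j) (tail D i j) ∧
      |tail (ratDist (I.estimate up T h)) i j - tail D i j| ≤
        radius (I.k * I.n * T).bits.length (obsCount (natHistory h) i j) := by
  have hℓ : 0 < (I.k * I.n * T).bits.length := by
    rw [Nat.size_eq_bits_len]
    exact Nat.size_pos.2 (Nat.mul_pos (Nat.mul_pos I.k_pos i.pos) hT)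
  exact tail_estimate hD I.k_pos up hℓ (Nat.succ_pos T) hM hh i j

open Classical in
/-- The expected loss in a period in which the policy is approximately optimal for the estimated
distributions. -/
theorem loss_estimate_le (hI : I.LeafConstant) {D : Fin I.n → Fin I.k → ℝ} (hD : IsDist D) {α : ℝ}
    {g : Goal} (hα : g.IsRatio α) {up : Bool}
    (hup : ∀ E, IsDist E → (∀ i m, OnSide up (tail E i m) (tail D i m)) → I.Optimistic E D g)
    {T : ℕ} (hT : 0 < T) {h : List (List (Obs I.n I.k))}
    (hM : ∀ (i : Fin I.n) j, obsCount (natHistory h) i j ≤ T + 1) {σ : Policy I.n I.k}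
    (hσ : σ ∈ I.feasible) (happ : I.IsApprox (ratDist (I.estimate up T h)) α σ g) :
    I.loss D α σ g ≤ I.fMax * ((if Accurate D (I.k * I.n * T).bits.length h then 0 else 1) +
      ∑ i : Fin I.n, ∑ r ∈ Finset.range (I.k - 1),
        radius (I.k * I.n * T).bits.length (obsCount (natHistory h) i (r + 1)) *
          pexp D fun x => ((σ.trace x).map (obsInd i (r + 1))).sum) := by
  by_cases hacc : Accurate D (I.k * I.n * T).bits.length h
  · have hE := isDist_ratDist (I.estimate_sum_pos up T h)
    have htail := tail_ratDist_estimate hD up hT hM hacc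
    rw [if_pos hacc, zero_add]
    exact (loss_le hD hα hσ happ (hup _ hE fun i m => (htail i m).1)).trans
      (abs_expected_sub_le hI hD hE hσ (ρ := fun i j =>
        radius (I.k * I.n * T).bits.length (obsCount (natHistory h) i j)) fun i j => (htail i j).2)
  · rw [if_neg hacc]
    refine (loss_le_fMax hD hα hσ).trans (le_mul_of_one_le_right I.fMax_nonneg ?_)
    refine le_add_of_nonneg_right (Finset.sum_nonneg fun i _ => Finset.sum_nonneg fun r _ =>
      mul_nonneg (radius_nonneg _ _) ?_)
    rw [← pexp_const hD 0]
    exact pexp_mono hD fun x => Nat.cast_nonneg _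

end Instance

end Censored

theorem theorem4p1 :
    ∃ C : ℝ, 0 < C ∧
      ∀ (P : Problem) (α : ℝ),
        P.goal.IsRatio α →
        (∀ I ∈ P.instances, I.LeafConstant) →
        (P.UpMonotone ∨ P.DownMonotone) →
        P.HasApproxAlgorithm α →
        ∃ (L : Prog) (q : Polynomial ℕ),
          ∀ I ∈ P.instances, ∀ T : ℕ,
            ∃ S : Strategy I.n I.k,
              I.Carries L T (q.eval (I.code.size + T)) S ∧
              ∀ D : Fin I.n → Fin I.k → ℝ, IsDist D →
                I.regret D T S α P.goal ≤
                  C * (I.n * I.k * I.fMax * √(I.k * T * Real.log (I.k * I.n * T))) := by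
  classical
  refine ⟨50, by norm_num, fun P α hα hleaf hmono ⟨A, qA, hA⟩ => ?_⟩
  obtain ⟨up, hup⟩ := Problem.exists_side hmono
  obtain ⟨L, q, hL⟩ := exists_learner up A qA
  refine ⟨L, q, fun I hI T => ?_⟩
  -- The strategy plays, for each history, the policy that the algorithm provides for the estimated
  -- distributions. The program was fixed before the instance and the horizon, so it is uniform in
  -- both.
  choose S hfeas happ hcomp using fun h : List (List (Obs I.n I.k)) =>
    hA I hI (I.estimate up T h) (I.estimate_sum_pos up T h)
  have honce : ∀ h, (S h).ProbesOnce := fun h => I.probesOnce _ (hfeas h)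
  refine ⟨S, fun xs hxs => ⟨hfeas _, hL I T _ _ ?_ ?_ (honce _) (hcomp _)⟩, fun D hD => ?_⟩
  · rw [Strategy.length_history]
    exact hxs.le
  · refine Strategy.history_induction S (p := fun h => ∀ τ ∈ h, τ.length ≤ I.n) (by simp) ?_ xs
    intro h x hh τ hτ
    rcases List.mem_append.1 hτ with hτ | hτ
    · exact hh τ hτ
    · obtain rfl := List.mem_singleton.1 hτ
      exact Policy.length_trace_le (honce h) x
  · rw [I.regret_eq hD]
    refine (sum_listExp_le hD honce (I.k * I.n * T).bits.length T I.fMax_nonneg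
      (fun h => I.loss D α (S h) P.goal) fun l hl => ?_).trans ?_
    -- The existence of a period gives `0 < T`, which makes the binary length positive whenever
    -- there is an item to estimate.
    · refine Instance.loss_estimate_le (hleaf I hI) hD hα (fun E hE => hup I hI D E hD hE)
        (Nat.zero_lt_of_lt hl) (fun i j => ?_) (hfeas _) (happ _)
      exact (Strategy.obsCount_history_le honce l i j).trans (by omega)
    · refine (mul_le_mul_of_nonneg_left (regret_sum_le I.n I.k T) I.fMax_nonneg).trans (le_of_eq ?_)
      ring
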